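/- Let $d\ge 0$ be an integer, $\mathbb T^d=(\mathbb R/2\pi\mathbb Z)^d$, $T^*\mathbb T^d=\mathbb T^d\times\mathbb R^d$, and let $H\in C^\infty(\mathbb R^d;\mathbb R)$. For $h>0$ let $S_h^t=e^{-i\frac th H(hD_x)}$ be the propagator on $L^2(\mathbb T^d)$, i.e. $\widehat{S_h^tu}(k)=e^{-i\frac th H(hk)}\,\widehat u(k)$ for $k\in\mathbb Z^d$, where $\widehat u(k)=(2\pi)^{-d/2}\int_{\mathbb T^d}u(x)e^{-ik\cdot x}\,dx$. For $u\in L^2(\mathbb T^d)$ let $w^h_u$ be its Wigner distribution, defined for $a\in C_c^\infty(T^*\mathbb T^d)$ by $$\langle w^h_u,a\rangle=\langle u,\mathrm{Op}_h(a)u\rangle_{L^2(\mathbb T^d)}=\frac1{(2\pi)^{d/2}}\sum_{k,j\in\mathbb Z^d}\widehat u(k)\,\overline{\widehat u(j)}\;\widehat a_{j-k}\Big(\frac h2(k+j)\Big),\qquad \widehat a_k(\xi)=\int_{\mathbb T^d}a(x,\xi)\frac{e^{-ik\cdot x}}{(2\pi)^{d/2}}\,dx,$$ where $\mathrm{Op}_h(a)$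 is the Weyl quantization of $a$. Let $L^\infty(\mathbb R;\mathcal M_+(T^*\mathbb T^d))$ be the set of measurable families $\mu=(\mu(t,\cdot))_{t\in\mathbb R}$ of positive measures on $T^*\mathbb T^d$ such that $t\mapsto\mu(t,K)$ is essentially bounded for every compact $K\subset T^*\mathbb T^d$, with the weak-$*$ topology, in which $\mu_n\to\mu$ means that $\int_{\mathbb R}\varphi(t)\int a\,d\mu_n(t,\cdot)\,dt\to\int_{\mathbb R}\varphi(t)\int a\,d\mu(t,\cdot)\,dt$ for all $\varphi\in L^1(\mathbb R)$ and $a\in C_c^\infty(T^*\mathbb T^d)$. For a function $\tau:(0,\infty)\to(0,\infty)$, $h\mapsto\tau_h$, let $\widetilde{\mathcal M}(\tau)$ be the set of all $\mu\in L^\infty(\mathbb R;\mathcal M_+(T^*\mathbb T^d))$ for which there are $h_n\to0^+$ and $u_n\in L^2(\mathbb T^d)$ with $\|u_n\|_{L^2(\mathbb T^d)}=1$ such that $$\int_{\mathbb R}\varphi(t)\,\big\langle w^{h_n}_{S_{h_n}^{\tau_{h_n}t}u_n},a\big\rangle\,dt\;\longrightarrow\;\int_{\mathbb R}\varphi(t)\int_{T^*\mathbb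 T^d}a(x,\xi)\,\mu(t,dx,d\xi)\,dt\qquad\text{for all }\varphi\in L^1(\mathbb R),\ a\in C_c^\infty(T^*\mathbb T^d).$$ **Proposition.** Let $\tau,\sigma:(0,\infty)\to(0,\infty)$ satisfy $\tau_h\to\infty$, $\sigma_h\to\infty$ and $\sigma_h/\tau_h\to0$ as $h\to0^+$. Then for every $\mu\in\widetilde{\mathcal M}(\tau)$ and almost every $t\in\mathbb R$ there exists $\mu^t$ in the weak-$*$ closed convex hull $\overline{\operatorname{Conv}\widetilde{\mathcal M}(\sigma)}$ such that $$\mu(t,\cdot)=\int_0^1\mu^t(s,\cdot)\,ds .$$ -/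

import Mathlib

open MeasureTheory ProbabilityTheory Filter Topology Set
open scoped ContDiff ComplexConjugate ENNReal NNReal

noncomputable section

namespace TorusSchrodinger

instance fact_two_pi_pos : Fact (0 < 2 * Real.pi) := ⟨Real.two_pi_pos⟩

/-- The torus `𝕋ᵈ = (ℝ / 2πℤ)ᵈ`. Its `volume` is the Lebesgue measure `dx`, of total mass `(2π)ᵈ`. -/
abbrev Torus (d : ℕ) : Type := Fin d → AddCircle (2 * Real.pi)

/-- The cotangent bundle `T*𝕋ᵈ = 𝕋ᵈ × (ℝᵈ)*`; covectors are given by their coordinates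
(no norm on `Fin d → ℝ` plays a role below, only its topology, smoothness and Borel sets). -/
abbrev Phase (d : ℕ) : Type := Torus d × (Fin d → ℝ)

/-- The Hilbert space `L²(𝕋ᵈ)` of complex functions, with the measure `dx`. -/
abbrev L2Torus (d : ℕ) : Type := Lp ℂ 2 (volume : Measure (Torus d))

variable {d : ℕ}

/-- The function `e_k(x) = (2π)^(-d/2) exp(i k·x)`, for `k ∈ ℤᵈ`. -/
def expo (k : Fin d → ℤ) : C(Torus d, ℂ) where
  toFun x := (((2 * Real.pi) ^ ((d : ℝ) / 2) : ℝ) : ℂ)⁻¹ * ∏ i, fourier (k i) (x i)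
  continuous_toFun := by fun_prop

/-- `e_k` as an element of `L²(𝕋ᵈ)`. -/
def expoL2 (k : Fin d → ℤ) : L2Torus d :=
  ContinuousMap.toLp (E := ℂ) 2 volume ℂ (expo k)

/-- Fourier coefficient `f̂(k) = ∫ f(x) (2π)^(-d/2) exp(-i k·x) dx`. -/
def torusCoeff (f : Torus d → ℂ) (k : Fin d → ℤ) : ℂ :=
  ∫ x, f x * conj (expo k x)

/-- The propagator `S_h^t = exp(-i (t/h) H(hD_x))` on `L²(𝕋ᵈ)`: since `H(hD_x) e_k = H(hk) e_k`,
it multiplies the `k`-th Fourier coefficient by `exp(-i (t/h) H(hk))`. The series converges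
in `L²(𝕋ᵈ)`. -/
def propagator (H : (Fin d → ℝ) → ℝ) (h t : ℝ) (u : L2Torus d) : L2Torus d :=
  ∑' k : Fin d → ℤ,
    (Complex.exp (-Complex.I * ((t / h * H (fun i => h * (k i : ℝ)) : ℝ) : ℂ))
      * torusCoeff u k) • expoL2 k

/-- The space `C_c^∞(T*𝕋ᵈ)` of complex test functions: smooth (after lifting to `ℝᵈ × ℝᵈ`)
and compactly supported. -/
structure TestFn (d : ℕ) where
  toFun : Phase d → ℂ
  smooth : ContDiff ℝ ∞ (fun p : (Fin d → ℝ) × (Fin d → ℝ) =>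
    toFun (fun i => (p.1 i : AddCircle (2 * Real.pi)), p.2))
  compact : HasCompactSupport toFun

instance : CoeFun (TestFn d) (fun _ => Phase d → ℂ) := ⟨TestFn.toFun⟩

/-- Fourier coefficient `â_k(ξ)` of a symbol `a(x, ξ)` with respect to `x`. -/
def symbolCoeff (a : TestFn d) (k : Fin d → ℤ) (ξ : Fin d → ℝ) : ℂ :=
  torusCoeff (fun x => a (x, ξ)) k

/-- The Weyl quantization `Op_h(a)` on `L²(𝕋ᵈ)`. In the basis `(e_k)` it is the operator with
matrix elements `⟨e_j, Op_h(a) e_k⟩ = (2π)^(-d/2) â_{j-k}(h (j + k) / 2)`: the Weyl operator of a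
symbol `b(ξ) exp(i m·x)` maps `e_k` to `b(h (k + m/2)) e_{k+m}`. -/
def weyl (h : ℝ) (a : TestFn d) (u : L2Torus d) : L2Torus d :=
  ∑' j : Fin d → ℤ,
    (∑' k : Fin d → ℤ, (((2 * Real.pi) ^ ((d : ℝ) / 2) : ℝ) : ℂ)⁻¹
      * symbolCoeff a (j - k) (fun i => h / 2 * ((k i : ℝ) + (j i : ℝ)))
      * torusCoeff u k) • expoL2 j

/-- The Wigner distribution of `u` at scale `h`, tested against `a`: `⟨u, Op_h(a) u⟩`. -/
def wigner (h : ℝ) (u : L2Torus d) (a : TestFn d) : ℂ :=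
  inner ℂ u (weyl h a u)

/-- (Representatives of) elements of `L^∞(ℝ; M₊(T*𝕋ᵈ))`: measurable families `t ↦ μ(t, ·)` of
positive measures on `T*𝕋ᵈ`, whose mass on each compact set is essentially bounded in `t`. -/
structure TimeMeasure (d : ℕ) where
  /-- `toKernel t` is the measure `μ(t, ·)`. -/
  toKernel : Kernel ℝ (Phase d)
  bounded : ∀ K : Set (Phase d), IsCompact K → ∃ C : ℝ≥0, ∀ᵐ t : ℝ, toKernel t K ≤ C

/-- The functional `(φ, a) ↦ ∫_ℝ φ(t) ∫ a dμ(t, ·) dt` on `L¹(ℝ) × C_c^∞(T*𝕋ᵈ)` given by `μ`.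
The weak-* topology on `L^∞(ℝ; M₊(T*𝕋ᵈ))` is the one of pointwise convergence of these. -/
def pairing (μ : TimeMeasure d) : Lp ℂ 1 (volume : Measure ℝ) → TestFn d → ℂ :=
  fun φ a => ∫ t, φ t * ∫ p, a p ∂(μ.toKernel t)

/-- `M̃(τ)`, for the Hamiltonian `H`: the set of weak-* limits, along sequences `h_n → 0⁺`, of the
time-scaled Wigner distributions `w_h(t, ·)` of `S_h^{τ_h t} u_h`, over all normalised sequences
`(u_{h_n})` in `L²(𝕋ᵈ)`. -/
def semiclassicalMeasures (H : (Fin d → ℝ) → ℝ) (τ : ℝ → ℝ) : Set (TimeMeasure d) :=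
  {μ | ∃ (h : ℕ → ℝ) (u : ℕ → L2Torus d),
    (∀ n, 0 < h n) ∧ Tendsto h atTop (𝓝 0) ∧ (∀ n, ‖u n‖ = 1) ∧
    ∀ (φ : Lp ℂ 1 (volume : Measure ℝ)) (a : TestFn d),
      Tendsto
        (fun n => ∫ t, φ t * wigner (h n) (propagator H (h n) (τ (h n) * t) (u n)) a)
        atTop (𝓝 (pairing μ φ a))}

/-- The weak-* closed convex hull of a subset of `L^∞(ℝ; M₊(T*𝕋ᵈ))`, the latter being seen as a
set of functionals on `L¹(ℝ) × C_c^∞(T*𝕋ᵈ)`. -/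
def closedConvHull (S : Set (TimeMeasure d)) : Set (TimeMeasure d) :=
  {μ | pairing μ ∈ closedConvexHull ℝ (pairing '' S)}

end TorusSchrodinger

end

/-!
# Semiclassical measures at a long time scale are averages of those at a shorter one

For almost every `t` the family `μᵗ` can be taken stationary: `μᵗ(s, ·) = μ(t, ·)` for all `s`, so
that the integral over `s ∈ [0, 1]` is trivially `μ(t, ·)`. What has to be shown is that this
stationary family lies in the closed convex hull of `M̃(σ)` (`const_mem_closedConvHull`).

Otherwise, by Hahn-Banach, a weak-* continuous functional, which involves only finitely many
`(φ, a)` (`exists_finset_sum_apply`), separates it from the hull. Let `w_n(t)` be the Wigner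
distribution of `S^{τ t} u_n`. By the group law, that of `S^{σ s} (S^{τ t'} u_n)` is
`w_n(t' + (σ/τ) s)`. Since `σ/τ → 0`, averaging it over `t' ∈ [t, t + δ]` gives in the limit the
average of `μ` over that interval, whatever `s` is (`tendsto_integral_integral_shift`), and this
average is close to `μ(t, ·)` when `t` is a Lebesgue point (`TimeMeasure.ae_tendsto_average`). So
for every large `n` some `t'_n` is at least as good as the average, and the states
`v_n = S^{τ t'_n} u_n` are normalised. By compactness, a subsequence of their time-scaled Wigner
distributions at scale `σ` converges to an element of `M̃(σ)`, on the wrong side of the separating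
hyperplane.

The compactness (`exists_subseq_tendsto_wigner`) contains the positivity of semiclassical
measures. In the Fourier basis the Wigner distribution is a quadratic form with absolutely summable
off-diagonals (`wigner_eq_quadForm`), because the Fourier coefficients `â_m(ξ)` decay summably in
`m`, uniformly in `ξ`. Averaging `|∑_{k ∈ j + window} c_k e_k(x)|²` over all translates of a cube
of `Nᵈ` frequencies gives a positive measure, a discrete Husimi measure. Its matrix elements differ
little from those of the Wigner distribution if `N → ∞` and `h N → 0`
(`exists_tendsto_quadForm_sub`). With time weighted by a Gaussian, the Husimi measures are
probability measures on space-time; they converge along a subsequence on a compactification, and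
the limit, whose time marginal is at most the Gaussian, is disintegrated in time.
-/

noncomputable section

namespace TorusSchrodinger

variable {d : ℕ}

/-! ### The Fourier basis of the torus -/

section FourierBasis

theorem two_pi_rpow_pos (d : ℕ) : 0 < ((2 * Real.pi) ^ ((d : ℝ) / 2) : ℝ) :=
  Real.rpow_pos_of_pos Real.two_pi_pos _

theorem two_pi_rpow_mul_self (d : ℕ) :
    ((2 * Real.pi) ^ ((d : ℝ) / 2) : ℝ) * ((2 * Real.pi) ^ ((d : ℝ) / 2) : ℝ)
      = (2 * Real.pi) ^ d := by
  rw [← Real.rpow_add Real.two_pi_pos, add_halves, Real.rpow_natCast]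

theorem expo_apply (k : Fin d → ℤ) (x : Torus d) :
    expo k x = (((2 * Real.pi) ^ ((d : ℝ) / 2) : ℝ) : ℂ)⁻¹ * ∏ i, fourier (k i) (x i) := rfl

theorem norm_expo (k : Fin d → ℤ) (x : Torus d) :
    ‖expo k x‖ = ((2 * Real.pi) ^ ((d : ℝ) / 2) : ℝ)⁻¹ := by
  rw [expo_apply, norm_mul, norm_inv, Complex.norm_real, norm_prod,
    Real.norm_of_nonneg (two_pi_rpow_pos d).le, Finset.prod_eq_one, mul_one]
  intro i _
  rw [fourier_apply, Circle.norm_coe]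

theorem conj_expo (k : Fin d → ℤ) (x : Torus d) : conj (expo k x) = expo (-k) x := by
  simp only [expo_apply, map_mul, map_inv₀, Complex.conj_ofReal, map_prod, Pi.neg_apply,
    fourier_neg]

theorem expo_mul_expo (k j : Fin d → ℤ) (x : Torus d) :
    expo k x * expo j x = (((2 * Real.pi) ^ ((d : ℝ) / 2) : ℝ) : ℂ)⁻¹ * expo (k + j) x := by
  simp only [expo_apply, Pi.add_apply, fourier_add, Finset.prod_mul_distrib]
  ring

theorem integral_fourier_two_pi (n : ℤ) :
    ∫ x : AddCircle (2 * Real.pi), fourier n x = if n = 0 then ((2 * Real.pi : ℝ) : ℂ) else 0 := by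
  have h := (orthonormal_iff_ite.mp (orthonormal_fourier (T := 2 * Real.pi))) 0 n
  simp only [ContinuousMap.inner_toLp, fourier_zero, map_one, mul_one] at h
  rw [AddCircle.volume_eq_smul_haarAddCircle, integral_smul_measure, h,
    ENNReal.toReal_ofReal Real.two_pi_pos.le]
  by_cases hn : n = 0
  · simp [hn]
  · rw [if_neg (fun h => hn h.symm), if_neg hn, smul_zero]

theorem integral_expo (k : Fin d → ℤ) :
    ∫ x, expo k x = if k = 0 then (((2 * Real.pi) ^ ((d : ℝ) / 2) : ℝ) : ℂ) else 0 := by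
  simp only [expo_apply]
  rw [integral_const_mul]
  have : (∫ x : Torus d, ∏ i, fourier (k i) (x i))
      = ∏ i, ∫ x : AddCircle (2 * Real.pi), fourier (k i) x :=
    MeasureTheory.integral_fintype_prod_volume_eq_prod
      (fun i (x : AddCircle (2 * Real.pi)) => fourier (k i) x)
  rw [this]
  simp only [integral_fourier_two_pi]
  split_ifs with h
  · subst h
    simp only [Pi.zero_apply, if_true, Finset.prod_const, Finset.card_univ, Fintype.card_fin]
    have h1 := two_pi_rpow_mul_self d
    have h2 : (((2 * Real.pi) ^ ((d : ℝ) / 2) : ℝ) : ℂ) ≠ 0 := by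
      exact_mod_cast (two_pi_rpow_pos d).ne'
    rw [inv_mul_eq_iff_eq_mul₀ h2]
    exact_mod_cast h1.symm
  · obtain ⟨i, hi⟩ := Function.ne_iff.mp h
    rw [Finset.prod_eq_zero (Finset.mem_univ i) (if_neg hi), mul_zero]

theorem orthonormal_expoL2 : Orthonormal ℂ (expoL2 (d := d)) := by
  rw [orthonormal_iff_ite]
  intro m n
  simp only [expoL2, ContinuousMap.inner_toLp, conj_expo, expo_mul_expo]
  rw [integral_const_mul, integral_expo]
  have h2 : (((2 * Real.pi) ^ ((d : ℝ) / 2) : ℝ) : ℂ) ≠ 0 := by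
    exact_mod_cast (two_pi_rpow_pos d).ne'
  by_cases h : m = n
  · rw [if_pos h, if_pos (by simp [h]), inv_mul_cancel₀ h2]
  · rw [if_neg h, if_neg (fun h' => h (by
      first
      | exact (neg_add_eq_zero.mp h')
      | exact (add_neg_eq_zero.mp h').symm)), mul_zero]

theorem expo_single (x : Torus d) (i : Fin d) :
    expo (Pi.single i 1) x
      = (((2 * Real.pi) ^ ((d : ℝ) / 2) : ℝ) : ℂ)⁻¹ * fourier 1 (x i) := by
  rw [expo_apply]
  congr 1
  rw [Finset.prod_eq_single i]
  · simp
  · intro j _ hj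
    simp [Pi.single_eq_of_ne hj]
  · simp

/-- Trigonometric polynomials are dense in the continuous functions. -/
theorem span_expo_closure_eq_top :
    (Submodule.span ℂ (range (expo (d := d)))).topologicalClosure = ⊤ := by
  have hc : (((2 * Real.pi) ^ ((d : ℝ) / 2) : ℝ) : ℂ) ≠ 0 := by
    exact_mod_cast (two_pi_rpow_pos d).ne'
  -- the span is a star subalgebra, so that Stone-Weierstrass applies
  have hmul : ∀ f ∈ Submodule.span ℂ (range (expo (d := d))),
      ∀ g ∈ Submodule.span ℂ (range (expo (d := d))),
      f * g ∈ Submodule.span ℂ (range (expo (d := d))) := by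
    intro f hf g hg
    have h := Submodule.mul_mem_mul hf hg
    rw [Submodule.span_mul_span] at h
    refine Submodule.span_le.mpr ?_ h
    rintro _ ⟨_, ⟨k, rfl⟩, _, ⟨j, rfl⟩, rfl⟩
    have : expo k * expo j = (((2 * Real.pi) ^ ((d : ℝ) / 2) : ℝ) : ℂ)⁻¹ • expo (d := d) (k + j) := by
      ext x
      simpa using expo_mul_expo k j x
    simp only [this]
    exact Submodule.smul_mem _ _ (Submodule.subset_span ⟨_, rfl⟩)
  have hone : (1 : C(Torus d, ℂ)) ∈ Submodule.span ℂ (range (expo (d := d))) := by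
    have : (1 : C(Torus d, ℂ)) = (((2 * Real.pi) ^ ((d : ℝ) / 2) : ℝ) : ℂ) • expo (d := d) 0 := by
      ext x
      simp [expo_apply, mul_inv_cancel₀ hc]
    rw [this]
    exact Submodule.smul_mem _ _ (Submodule.subset_span ⟨_, rfl⟩)
  have hstar : ∀ f ∈ Submodule.span ℂ (range (expo (d := d))),
      star f ∈ Submodule.span ℂ (range (expo (d := d))) := by
    intro f hf
    induction hf using Submodule.span_induction with
    | mem f hf =>
      obtain ⟨k, rfl⟩ := hf
      have : star (expo (d := d) k) = expo (-k) := by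
        ext x
        simpa using conj_expo k x
      rw [this]
      exact Submodule.subset_span ⟨_, rfl⟩
    | zero => simp
    | add f g _ _ hf hg => rw [star_add]; exact Submodule.add_mem _ hf hg
    | smul c f _ hf => rw [star_smul]; exact Submodule.smul_mem _ _ hf
  let A : StarSubalgebra ℂ C(Torus d, ℂ) :=
    { Submodule.toSubalgebra (Submodule.span ℂ (range (expo (d := d)))) hone
        (fun f g hf hg => hmul f hf g hg) with
      star_mem' := fun {f} hf => hstar f hf }
  have hsep : A.SeparatesPoints := by
    intro x y hxy
    rw [Ne, funext_iff, not_forall] at hxy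
    obtain ⟨i, hi⟩ := hxy
    refine ⟨_, ⟨expo (Pi.single i 1), Submodule.subset_span ⟨_, rfl⟩, rfl⟩, ?_⟩
    dsimp only
    rw [expo_single, expo_single, fourier_one, fourier_one, Ne, mul_right_inj' (inv_ne_zero hc)]
    contrapose hi
    refine AddCircle.injective_toCircle Real.two_pi_pos.ne' (Circle.ext hi)
  have h := ContinuousMap.starSubalgebra_topologicalClosure_eq_top_of_separatesPoints A hsep
  exact congr_arg (Subalgebra.toSubmodule <| StarSubalgebra.toSubalgebra ·) h

theorem span_expoL2_closure_eq_top :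
    (Submodule.span ℂ (range (expoL2 (d := d)))).topologicalClosure = ⊤ := by
  have h := (ContinuousMap.toLp_denseRange ℂ (volume : Measure (Torus d)) ℂ
      (p := 2) (by simp)).topologicalClosure_map_submodule
      (span_expo_closure_eq_top (d := d))
  simpa only [Submodule.map_span, ContinuousLinearMap.coe_coe, ← range_comp, Function.comp_def]
    using! h

/-- The exponentials `e_k`, `k ∈ ℤᵈ`, as a Hilbert basis of `L²(𝕋ᵈ)`. -/
def expoBasis (d : ℕ) : HilbertBasis (Fin d → ℤ) ℂ (L2Torus d) :=
  HilbertBasis.mk orthonormal_expoL2 span_expoL2_closure_eq_top.ge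

theorem coe_expoBasis : ⇑(expoBasis d) = expoL2 := HilbertBasis.coe_mk _ _

theorem inner_expoL2 (u : L2Torus d) (k : Fin d → ℤ) :
    inner ℂ (expoL2 k) u = torusCoeff u k := by
  rw [MeasureTheory.L2.inner_def, torusCoeff]
  apply integral_congr_ae
  filter_upwards [ContinuousMap.coeFn_toLp (p := 2) (𝕜 := ℂ) (volume : Measure (Torus d)) (expo k)]
    with x hx
  rw [RCLike.inner_apply, expoL2, hx]

theorem hasSum_norm_sq_torusCoeff (u : L2Torus d) :
    HasSum (fun k => ‖torusCoeff u k‖ ^ 2) (‖u‖ ^ 2) := by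
  have h := RCLike.hasSum_re ℂ ((expoBasis d).hasSum_inner_mul_inner u u)
  rw [inner_self_eq_norm_sq] at h
  refine h.congr_fun fun k => ?_
  rw [coe_expoBasis, ← inner_conj_symm, inner_expoL2, RCLike.conj_mul]
  norm_cast

/-- Every square summable family is the family of Fourier coefficients of the sum of its Fourier
series. -/
theorem exists_hasSum_expoL2 {c : (Fin d → ℤ) → ℂ} (hc : Summable fun k => ‖c k‖ ^ 2) :
    ∃ v : L2Torus d, HasSum (fun k => c k • expoL2 k) v ∧ ∀ k, torusCoeff v k = c k := by
  have hmem : Memℓp c 2 := memℓp_gen (by simpa using hc)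
  refine ⟨(expoBasis d).repr.symm ⟨c, hmem⟩, ?_, fun k => ?_⟩
  · simpa only [coe_expoBasis] using (expoBasis d).hasSum_repr_symm ⟨c, hmem⟩
  · rw [← inner_expoL2, ← coe_expoBasis, ← HilbertBasis.repr_apply_apply]
    simp

theorem ext_torusCoeff {u v : L2Torus d} (h : ∀ k, torusCoeff u k = torusCoeff v k) : u = v := by
  apply (expoBasis d).repr.injective
  ext k
  rw [HilbertBasis.repr_apply_apply, HilbertBasis.repr_apply_apply, coe_expoBasis, inner_expoL2,
    inner_expoL2, h]

end FourierBasis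

/-! ### The propagator in the Fourier basis -/

section Propagator

variable (H : (Fin d → ℝ) → ℝ)

theorem torusCoeff_propagator (h t : ℝ) (u : L2Torus d) (k : Fin d → ℤ) :
    torusCoeff (propagator H h t u) k
      = Complex.exp (-Complex.I * ((t / h * H (fun i => h * (k i : ℝ)) : ℝ) : ℂ))
        * torusCoeff u k := by
  have hn : ∀ k : Fin d → ℤ, ‖Complex.exp (-Complex.I * ((t / h * H (fun i => h * (k i : ℝ)) : ℝ) : ℂ))
      * torusCoeff u k‖ = ‖torusCoeff u k‖ := fun k => by
    rw [norm_mul, neg_mul, ← mul_neg, ← Complex.ofReal_neg, Complex.norm_exp_I_mul_ofReal, one_mul]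
  obtain ⟨v, hv, hvc⟩ := exists_hasSum_expoL2 (d := d)
    (c := fun k => Complex.exp (-Complex.I * ((t / h * H (fun i => h * (k i : ℝ)) : ℝ) : ℂ))
      * torusCoeff u k) (by simpa only [hn] using (hasSum_norm_sq_torusCoeff u).summable)
  rw [propagator, hv.tsum_eq, hvc]

theorem norm_torusCoeff_propagator (h t : ℝ) (u : L2Torus d) (k : Fin d → ℤ) :
    ‖torusCoeff (propagator H h t u) k‖ = ‖torusCoeff u k‖ := by
  rw [torusCoeff_propagator, norm_mul, neg_mul, ← mul_neg, ← Complex.ofReal_neg,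
    Complex.norm_exp_I_mul_ofReal, one_mul]

theorem norm_propagator (h t : ℝ) (u : L2Torus d) : ‖propagator H h t u‖ = ‖u‖ := by
  have h1 := hasSum_norm_sq_torusCoeff (propagator H h t u)
  simp only [norm_torusCoeff_propagator] at h1
  have h2 := h1.unique (hasSum_norm_sq_torusCoeff u)
  exact (sq_eq_sq₀ (norm_nonneg _) (norm_nonneg _)).mp h2

theorem propagator_propagator (h s t : ℝ) (u : L2Torus d) :
    propagator H h s (propagator H h t u) = propagator H h (s + t) u := by
  refine ext_torusCoeff fun k => ?_
  rw [torusCoeff_propagator, torusCoeff_propagator, torusCoeff_propagator, ← mul_assoc,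
    ← Complex.exp_add]
  congr 2
  push_cast
  ring

end Propagator

/-! ### Fourier coefficients of symbols -/

section Symbols

/-- The covering map `ℝᵈ × ℝᵈ → T*𝕋ᵈ`. -/
def cover (d : ℕ) (p : (Fin d → ℝ) × (Fin d → ℝ)) : Phase d :=
  (fun i => (p.1 i : AddCircle (2 * Real.pi)), p.2)

theorem isOpenQuotientMap_cover : IsOpenQuotientMap (cover d) :=
  (IsOpenQuotientMap.piMap fun _ : Fin d =>
    QuotientAddGroup.isOpenQuotientMap_mk (N := AddSubgroup.zmultiples (2 * Real.pi))).prodMap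
    IsOpenQuotientMap.id

theorem TestFn.continuous (a : TestFn d) : Continuous a.toFun := by
  rw [(isOpenQuotientMap_cover (d := d)).isQuotientMap.continuous_iff]
  exact a.smooth.continuous

theorem TestFn.exists_bound (a : TestFn d) : ∃ C, 0 ≤ C ∧ ∀ p, ‖a p‖ ≤ C := by
  obtain ⟨C, hC⟩ := a.compact.exists_bound_of_continuous a.continuous
  exact ⟨max C 0, le_max_right _ _, fun p => (hC p).trans (le_max_left _ _)⟩

/-- The translate of a point of the torus by `s` in the `i`-th direction. -/
def shift (i : Fin d) (x : Torus d) (s : ℝ) : Torus d :=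
  x + Pi.single i (s : AddCircle (2 * Real.pi))

theorem cover_add_smul (p : (Fin d → ℝ) × (Fin d → ℝ)) (i : Fin d) (s : ℝ) :
    cover d (p + s • (Pi.single i 1, 0)) = (shift i (cover d p).1 s, (cover d p).2) := by
  refine Prod.ext ?_ ?_
  · funext j
    by_cases h : j = i
    · subst h
      simp [cover, shift]
    · simp [cover, shift, Pi.single_eq_of_ne h]
  · simp [cover]

theorem hasDerivAt_cover (a : TestFn d) (p : (Fin d → ℝ) × (Fin d → ℝ)) (i : Fin d) :
    HasDerivAt (fun s : ℝ => a (shift i (cover d p).1 s, (cover d p).2))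
      (fderiv ℝ (fun q => a (cover d q)) p (Pi.single i 1, 0)) 0 := by
  have h1 : DifferentiableAt ℝ (fun q => a (cover d q)) p :=
    a.smooth.differentiable (by simp) p
  have h2 : HasDerivAt (fun s : ℝ => p + s • ((Pi.single i 1 : Fin d → ℝ), (0 : Fin d → ℝ)))
      (Pi.single i 1, 0) 0 := by
    simpa using ((hasDerivAt_id (0 : ℝ)).smul_const
      ((Pi.single i 1 : Fin d → ℝ), (0 : Fin d → ℝ))).const_add p
  have h3 : HasFDerivAt (fun q => a (cover d q)) (fderiv ℝ (fun q => a (cover d q)) p)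
      (p + (0 : ℝ) • ((Pi.single i 1 : Fin d → ℝ), (0 : Fin d → ℝ))) := by
    simpa using h1.hasFDerivAt
  have h := h3.comp_hasDerivAt (0 : ℝ) h2
  simpa only [Function.comp_def, cover_add_smul] using h

/-- The partial derivative `∂a/∂x_i` of a test function. -/
def TestFn.partialDeriv (a : TestFn d) (i : Fin d) : TestFn d where
  toFun p := deriv (fun s : ℝ => a (shift i p.1 s, p.2)) 0
  smooth := by
    have h : (fun p : (Fin d → ℝ) × (Fin d → ℝ) =>
        deriv (fun s : ℝ => a (shift i (cover d p).1 s, (cover d p).2)) 0)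
        = fun p => fderiv ℝ (fun q => a (cover d q)) p (Pi.single i 1, 0) :=
      funext fun p => (hasDerivAt_cover a p i).deriv
    have h2 : ContDiff ℝ ∞ (fun q => a (cover d q)) := a.smooth
    have h3 : ContDiff ℝ ∞ (fun p => fderiv ℝ (fun q => a (cover d q)) p
        (Pi.single i 1, 0)) :=
      (h2.fderiv_right (m := ∞) (by simp)).clm_apply contDiff_const
    rw [← h] at h3
    exact h3
  compact := by
    refine HasCompactSupport.of_support_subset_isCompact a.compact fun p hp => ?_
    by_contra hn
    refine hp ?_
    have h0 : ∀ᶠ q in 𝓝 p, a q = 0 := by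
      filter_upwards [(isClosed_tsupport _).isOpen_compl.mem_nhds hn] with q hq
      exact image_eq_zero_of_notMem_tsupport hq
    have hc : Continuous fun s : ℝ => ((shift i p.1 s, p.2) : Phase d) := by
      unfold shift
      refine Continuous.prodMk (continuous_const.add ?_) continuous_const
      exact (continuous_single i).comp (AddCircle.continuous_mk' _)
    have h00 : ((shift i p.1 0, p.2) : Phase d) = p := by simp [shift]
    have h1 : ∀ᶠ s : ℝ in 𝓝 0, a (shift i p.1 s, p.2) = 0 := by
      refine hc.continuousAt.eventually (p := fun q => a q = 0) ?_
      beta_reduce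
      rw [h00]
      exact h0
    have h2 : (fun s : ℝ => a (shift i p.1 s, p.2)) =ᶠ[𝓝 0] fun _ => 0 := h1
    exact h2.deriv_eq.trans (deriv_const _ _)

theorem shift_shift (i : Fin d) (x : Torus d) (s t : ℝ) :
    shift i (shift i x s) t = shift i x (s + t) := by
  simp only [shift, add_assoc, ← Pi.single_add, AddCircle.coe_add]

theorem TestFn.hasDerivAt_shift (a : TestFn d) (i : Fin d) (x : Torus d) (ξ : Fin d → ℝ) (s : ℝ) :
    HasDerivAt (fun s : ℝ => a (shift i x s, ξ)) (a.partialDeriv i (shift i x s, ξ)) s := by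
  obtain ⟨p, hp⟩ := (isOpenQuotientMap_cover (d := d)).surjective (shift i x s, ξ)
  have h := (hasDerivAt_cover a p i).differentiableAt.hasDerivAt
  rw [hp] at h
  have h' := HasDerivAt.comp_sub_const (f := fun t : ℝ => a (shift i (shift i x s) t, ξ)) s s
    (by rw [sub_self]; exact h)
  simpa [TestFn.partialDeriv, shift_shift] using h'

theorem expo_shift (m : Fin d → ℤ) (i : Fin d) (x : Torus d) (s : ℝ) :
    expo m (shift i x s) = Complex.exp (Complex.I * m i * s) * expo m x := by
  have h1 : ∏ j, fourier (m j) (shift i x s j)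
      = Complex.exp (Complex.I * m i * s) * ∏ j, fourier (m j) (x j) := by
    rw [← Finset.mul_prod_erase _ _ (Finset.mem_univ i),
      ← Finset.mul_prod_erase _ (fun j => fourier (m j) (x j)) (Finset.mem_univ i), ← mul_assoc]
    congr 1
    · have : fourier (m i) ((s : ℝ) : AddCircle (2 * Real.pi)) = Complex.exp (Complex.I * m i * s) := by
        rw [fourier_coe_apply]
        congr 1
        have : (Real.pi : ℂ) ≠ 0 := by exact_mod_cast Real.pi_ne_zero
        push_cast
        field_simp
      rw [← this, shift, Pi.add_apply, Pi.single_eq_same, fourier_apply, smul_add,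
        AddCircle.toCircle_add, Circle.coe_mul, fourier_apply, fourier_apply, mul_comm]
    · refine Finset.prod_congr rfl fun j hj => ?_
      rw [shift, Pi.add_apply, Pi.single_eq_of_ne (Finset.ne_of_mem_erase hj), add_zero]
  rw [expo_apply, expo_apply, h1]
  ring

/-- Differentiation in `x_i` multiplies the Fourier coefficients by `i m_i`: both sides are the
derivative at `s = 0` of the Fourier coefficient of the translate `a(x + s e_i, ξ)`. -/
theorem symbolCoeff_partialDeriv (a : TestFn d) (i : Fin d) (m : Fin d → ℤ) (ξ : Fin d → ℝ) :
    symbolCoeff (a.partialDeriv i) m ξ = Complex.I * m i * symbolCoeff a m ξ := by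
  have htr : ∀ s : ℝ, ∫ x, a (shift i x s, ξ) * conj (expo m x)
      = Complex.exp (Complex.I * m i * s) * symbolCoeff a m ξ := by
    intro s
    have h := integral_add_right_eq_self (μ := (volume : Measure (Torus d)))
      (fun x => a (x, ξ) * conj (expo m (shift i x (-s))))
      (Pi.single i (s : AddCircle (2 * Real.pi)))
    have h1 : ∀ x : Torus d, shift i (x + Pi.single i (s : AddCircle (2 * Real.pi))) (-s) = x :=
      fun x => by
        change shift i (shift i x s) (-s) = x
        rw [shift_shift, add_neg_cancel]; simp [shift]
    simp only [h1] at h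
    change ∫ x, a (shift i x s, ξ) * conj (expo m x) = _ at h
    rw [h, symbolCoeff, torusCoeff, ← integral_const_mul]
    congr 1
    funext x
    rw [expo_shift, map_mul, ← Complex.exp_conj]
    simp only [map_mul, Complex.conj_I, Complex.conj_ofReal]
    rw [show conj ((m i : ℂ)) = m i from map_intCast (starRingEnd ℂ) _]
    push_cast
    rw [show -Complex.I * m i * (-s : ℂ) = Complex.I * m i * s by ring]
    ring
  obtain ⟨C, hC0, hC⟩ := (a.partialDeriv i).exists_bound
  have hsc : ∀ s : ℝ, Continuous fun x : Torus d => ((shift i x s, ξ) : Phase d) := fun s => by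
    unfold shift
    fun_prop
  have hec : Continuous fun x : Torus d => conj (expo m x) :=
    Complex.continuous_conj.comp (expo m).continuous
  have hcont : ∀ (b : TestFn d) (s : ℝ),
      Continuous fun x : Torus d => b (shift i x s, ξ) * conj (expo m x) := fun b s =>
    (b.continuous.comp (hsc s)).mul hec
  have h1 := (hasDerivAt_integral_of_dominated_loc_of_deriv_le
    (μ := (volume : Measure (Torus d)))
    (F := fun (s : ℝ) x => a (shift i x s, ξ) * conj (expo m x))
    (F' := fun (s : ℝ) x => a.partialDeriv i (shift i x s, ξ) * conj (expo m x))
    (x₀ := 0) (s := univ) (bound := fun _ => C * ((2 * Real.pi) ^ ((d : ℝ) / 2) : ℝ)⁻¹)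
    univ_mem (Eventually.of_forall fun s => (hcont a s).aestronglyMeasurable)
    ((hcont a 0).integrable_of_hasCompactSupport (HasCompactSupport.of_compactSpace _))
    (hcont _ 0).aestronglyMeasurable
    (Eventually.of_forall fun x s _ => by
      rw [norm_mul, RCLike.norm_conj, norm_expo]
      exact mul_le_mul_of_nonneg_right (hC _) (inv_nonneg.mpr (two_pi_rpow_pos d).le))
    (integrable_const _)
    (Eventually.of_forall fun x s _ => (a.hasDerivAt_shift i x ξ s).mul_const _)).2
  simp only [htr] at h1
  have h2 : HasDerivAt (fun s : ℝ => Complex.exp (Complex.I * m i * s) * symbolCoeff a m ξ)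
      (Complex.I * m i * symbolCoeff a m ξ) 0 := by
    have h3 : HasDerivAt (fun s : ℝ => Complex.I * m i * (s : ℂ)) (Complex.I * m i) 0 := by
      simpa using (Complex.ofRealCLM.hasDerivAt (x := (0 : ℝ))).const_mul (Complex.I * (m i : ℂ))
    simpa using h3.cexp.mul_const (symbolCoeff a m ξ)
  have h4 := h1.unique h2
  rw [← h4, symbolCoeff, torusCoeff]
  simp [shift]

theorem TestFn.exists_symbolCoeff_bound (a : TestFn d) :
    ∃ C, ∀ (m : Fin d → ℤ) (ξ : Fin d → ℝ), ‖symbolCoeff a m ξ‖ ≤ C := by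
  obtain ⟨C, hC0, hC⟩ := a.exists_bound
  refine ⟨_, fun m ξ => norm_integral_le_of_norm_le_const
    (C := C * ((2 * Real.pi) ^ ((d : ℝ) / 2) : ℝ)⁻¹) (Eventually.of_forall fun x => ?_)⟩
  rw [norm_mul, RCLike.norm_conj, norm_expo]
  exact mul_le_mul_of_nonneg_right (hC _) (inv_nonneg.mpr (two_pi_rpow_pos d).le)

/-- Polynomial decay of Fourier coefficients, by induction on `s`: multiplication by `1 + m_i²` is
the effect of `1 - ∂²/∂x_i²`. -/
theorem TestFn.exists_symbolCoeff_prod_bound (s : Finset (Fin d)) (a : TestFn d) :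
    ∃ C, ∀ (m : Fin d → ℤ) (ξ : Fin d → ℝ),
      (∏ i ∈ s, (1 + (m i : ℝ) ^ 2)) * ‖symbolCoeff a m ξ‖ ≤ C := by
  induction s using Finset.induction_on generalizing a with
  | empty => simpa using a.exists_symbolCoeff_bound
  | insert i s hi ih =>
    obtain ⟨C, hC⟩ := ih a
    obtain ⟨C', hC'⟩ := ih ((a.partialDeriv i).partialDeriv i)
    refine ⟨C + C', fun m ξ => ?_⟩
    have h := hC' m ξ
    rw [symbolCoeff_partialDeriv, symbolCoeff_partialDeriv] at h
    simp only [norm_mul, Complex.norm_I, one_mul, Complex.norm_intCast] at h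
    rw [Finset.prod_insert hi]
    calc _ = (∏ j ∈ s, (1 + (m j : ℝ) ^ 2)) * ‖symbolCoeff a m ξ‖
        + (∏ j ∈ s, (1 + (m j : ℝ) ^ 2)) * (|(m i : ℝ)| * (|(m i : ℝ)| * ‖symbolCoeff a m ξ‖)) := by
          rw [← mul_assoc |(m i : ℝ)|, abs_mul_abs_self]
          ring
      _ ≤ C + C' := add_le_add (hC m ξ) h

theorem summable_inv_one_add_sq : Summable fun n : ℤ => (1 + (n : ℝ) ^ 2)⁻¹ := by
  have h1 : Summable fun n : ℤ => 1 / (n : ℝ) ^ 2 := Real.summable_one_div_int_pow.mpr one_lt_two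
  refine Summable.of_nonneg_of_le (fun n => by positivity) (fun n => ?_)
    (h1.add (hasSum_ite_eq (0 : ℤ) (1 : ℝ)).summable)
  by_cases hn : n = 0
  · simp [hn]
  · rw [if_neg hn, add_zero, one_div]
    have : (0 : ℝ) < (n : ℝ) ^ 2 := by positivity
    exact inv_anti₀ this (by linarith)

/-- A finite subset of `ℤᵈ` lies in a box, over which the sum of a product is a product of sums. -/
theorem summable_prod_inv_one_add_sq (d : ℕ) :
    Summable fun m : Fin d → ℤ => ∏ i, (1 + (m i : ℝ) ^ 2)⁻¹ := by
  classical
  refine summable_of_sum_le (c := ∏ _i : Fin d, ∑' n : ℤ, (1 + (n : ℝ) ^ 2)⁻¹)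
    (fun m => Finset.prod_nonneg fun i _ => by positivity) fun u => ?_
  calc ∑ m ∈ u, ∏ i, (1 + (m i : ℝ) ^ 2)⁻¹
      ≤ ∑ m ∈ Fintype.piFinset (fun i => u.image fun m : Fin d → ℤ => m i),
          ∏ i, (1 + (m i : ℝ) ^ 2)⁻¹ := by
        refine Finset.sum_le_sum_of_subset_of_nonneg (fun m hm => ?_)
          fun m _ _ => Finset.prod_nonneg fun i _ => by positivity
        rw [Fintype.mem_piFinset]
        exact fun i => Finset.mem_image_of_mem (fun m => m i) hm
    _ = ∏ i, ∑ n ∈ u.image (fun m : Fin d → ℤ => m i), (1 + ((n : ℤ) : ℝ) ^ 2)⁻¹ :=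
        (Finset.prod_univ_sum (fun i => u.image fun m => m i)
          (fun _ (n : ℤ) => (1 + (n : ℝ) ^ 2)⁻¹)).symm
    _ ≤ _ := Finset.prod_le_prod (fun i _ => Finset.sum_nonneg fun n _ => by positivity)
        fun i _ => summable_inv_one_add_sq.sum_le_tsum _ fun n _ => by positivity

/-- The matrix elements of the symbol, `(2π)^(-d/2) â_m(ξ)`. -/
def weylCoeff (a : TestFn d) (m : Fin d → ℤ) (ξ : Fin d → ℝ) : ℂ :=
  (((2 * Real.pi) ^ ((d : ℝ) / 2) : ℝ) : ℂ)⁻¹ * symbolCoeff a m ξ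

/-- Fourier coefficients of a symbol decay summably, uniformly in `ξ`. -/
theorem exists_summable_weylCoeff_bound (a : TestFn d) :
    ∃ A : (Fin d → ℤ) → ℝ, Summable A ∧ ∀ m ξ, ‖weylCoeff a m ξ‖ ≤ A m := by
  obtain ⟨C, hC⟩ := a.exists_symbolCoeff_prod_bound Finset.univ
  refine ⟨fun m => ((2 * Real.pi) ^ ((d : ℝ) / 2) : ℝ)⁻¹ * (C * ∏ i, (1 + (m i : ℝ) ^ 2)⁻¹),
    ((summable_prod_inv_one_add_sq d).mul_left C).mul_left _, fun m ξ => ?_⟩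
  rw [weylCoeff, norm_mul, norm_inv, Complex.norm_real, Real.norm_of_nonneg (two_pi_rpow_pos d).le]
  refine mul_le_mul_of_nonneg_left ?_ (inv_nonneg.mpr (two_pi_rpow_pos d).le)
  have hp : 0 < ∏ i, (1 + (m i : ℝ) ^ 2) := Finset.prod_pos fun i _ => by positivity
  rw [Finset.prod_inv_distrib, ← div_eq_mul_inv, le_div_iff₀ hp, mul_comm]
  exact hC m ξ

theorem uniformContinuous_weylCoeff (a : TestFn d) (m : Fin d → ℤ) :
    UniformContinuous (weylCoeff a m) := by
  obtain ⟨C, hC0, hC⟩ := a.exists_bound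
  have hec : Continuous fun x : Torus d => conj (expo m x) :=
    Complex.continuous_conj.comp (expo m).continuous
  have hcont : Continuous (symbolCoeff a m) := by
    refine continuous_of_dominated (bound := fun _ => C * ((2 * Real.pi) ^ ((d : ℝ) / 2) : ℝ)⁻¹)
      (fun ξ => ?_) (fun ξ => Eventually.of_forall fun x => ?_) (integrable_const _)
      (Eventually.of_forall fun x => ?_)
    · exact ((a.continuous.comp (by fun_prop)).mul hec).aestronglyMeasurable
    · rw [norm_mul, RCLike.norm_conj, norm_expo]
      exact mul_le_mul_of_nonneg_right (hC _) (inv_nonneg.mpr (two_pi_rpow_pos d).le)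
    · exact (a.continuous.comp (by fun_prop)).mul continuous_const
  have hsupp : HasCompactSupport (symbolCoeff a m) := by
    refine HasCompactSupport.of_support_subset_isCompact
      (a.compact.isCompact.image continuous_snd) fun ξ hξ => ?_
    by_contra hn
    refine hξ ?_
    have : ∀ x : Torus d, a (x, ξ) = 0 := fun x => by
      by_contra hx
      exact hn ⟨(x, ξ), subset_tsupport _ hx, rfl⟩
    simp [symbolCoeff, torusCoeff, this]
  exact HasCompactSupport.uniformContinuous_of_continuous (hsupp.mul_left)
    (continuous_const.mul hcont)

end Symbols

/-! ### Quadratic forms with summable off-diagonals, and the Wigner distribution -/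

section QuadForm

variable {β : (Fin d → ℤ) → (Fin d → ℤ) → ℂ} {c : (Fin d → ℤ) → ℂ} {A : (Fin d → ℤ) → ℝ}

/-- The quadratic form `∑_{m,k} β_m(k) c_k conj(c_{k+m})`, with matrix elements sorted by their
off-diagonal `m`. -/
def quadForm (β : (Fin d → ℤ) → (Fin d → ℤ) → ℂ) (c : (Fin d → ℤ) → ℂ) : ℂ :=
  ∑' p : (Fin d → ℤ) × (Fin d → ℤ), β p.1 p.2 * (c p.2 * conj (c (p.2 + p.1)))

theorem hasSum_norm_sq_add (hc : Summable fun k => ‖c k‖ ^ 2) (m : Fin d → ℤ) :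
    HasSum (fun k => ‖c (k + m)‖ ^ 2) (∑' k, ‖c k‖ ^ 2) :=
  (Equiv.hasSum_iff (f := fun k => ‖c k‖ ^ 2) (Equiv.addRight m)).mpr hc.hasSum

theorem norm_mul_norm_le_half (k m : Fin d → ℤ) :
    ‖c k‖ * ‖c (k + m)‖ ≤ (‖c k‖ ^ 2 + ‖c (k + m)‖ ^ 2) / 2 := by
  have := two_mul_le_add_sq ‖c k‖ ‖c (k + m)‖
  linarith

theorem summable_norm_mul_norm_add (hc : Summable fun k => ‖c k‖ ^ 2) (m : Fin d → ℤ) :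
    Summable fun k => ‖c k‖ * ‖c (k + m)‖ :=
  Summable.of_nonneg_of_le (fun k => by positivity) (fun k => norm_mul_norm_le_half k m)
    ((hc.add (hasSum_norm_sq_add hc m).summable).div_const 2)

theorem tsum_norm_mul_norm_add_le (hc : Summable fun k => ‖c k‖ ^ 2) (m : Fin d → ℤ) :
    ∑' k, ‖c k‖ * ‖c (k + m)‖ ≤ ∑' k, ‖c k‖ ^ 2 := by
  have h := (hc.hasSum.add (hasSum_norm_sq_add hc m)).div_const 2
  refine (Summable.tsum_le_tsum (fun k => norm_mul_norm_le_half k m)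
    (summable_norm_mul_norm_add hc m) h.summable).trans ?_
  rw [h.tsum_eq]
  linarith

theorem summable_quadForm_majorant (hA : Summable A) (hA0 : ∀ m, 0 ≤ A m)
    (hc : Summable fun k => ‖c k‖ ^ 2) :
    Summable fun p : (Fin d → ℤ) × (Fin d → ℤ) => A p.1 * (‖c p.2‖ * ‖c (p.2 + p.1)‖) := by
  rw [summable_prod_of_nonneg
    (fun p => mul_nonneg (hA0 p.1) (mul_nonneg (norm_nonneg _) (norm_nonneg _)))]
  refine ⟨fun m => (summable_norm_mul_norm_add hc m).mul_left (A m), ?_⟩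
  dsimp only
  refine Summable.of_nonneg_of_le (fun m => tsum_nonneg fun k =>
    mul_nonneg (hA0 _) (mul_nonneg (norm_nonneg _) (norm_nonneg _))) (fun m => ?_)
    (hA.mul_right (∑' k, ‖c k‖ ^ 2))
  rw [tsum_mul_left]
  exact mul_le_mul_of_nonneg_left (tsum_norm_mul_norm_add_le hc m) (hA0 m)

theorem norm_quadForm_term_le (hβ : ∀ m k, ‖β m k‖ ≤ A m) (p : (Fin d → ℤ) × (Fin d → ℤ)) :
    ‖β p.1 p.2 * (c p.2 * conj (c (p.2 + p.1)))‖ ≤ A p.1 * (‖c p.2‖ * ‖c (p.2 + p.1)‖) := by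
  rw [norm_mul, norm_mul, RCLike.norm_conj]
  exact mul_le_mul_of_nonneg_right (hβ _ _) (by positivity)

theorem summable_norm_quadForm (hA : Summable A) (hβ : ∀ m k, ‖β m k‖ ≤ A m)
    (hc : Summable fun k => ‖c k‖ ^ 2) :
    Summable fun p : (Fin d → ℤ) × (Fin d → ℤ) => ‖β p.1 p.2 * (c p.2 * conj (c (p.2 + p.1)))‖ :=
  Summable.of_nonneg_of_le (fun _ => norm_nonneg _) (norm_quadForm_term_le hβ)
    (summable_quadForm_majorant hA (fun m => (norm_nonneg _).trans (hβ m 0)) hc)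

theorem summable_quadForm (hA : Summable A) (hβ : ∀ m k, ‖β m k‖ ≤ A m)
    (hc : Summable fun k => ‖c k‖ ^ 2) :
    Summable fun p : (Fin d → ℤ) × (Fin d → ℤ) => β p.1 p.2 * (c p.2 * conj (c (p.2 + p.1))) :=
  (summable_norm_quadForm hA hβ hc).of_norm

/-- Schur's bound. -/
theorem norm_quadForm_le (hA : Summable A) (hβ : ∀ m k, ‖β m k‖ ≤ A m)
    (hc : Summable fun k => ‖c k‖ ^ 2) :
    ‖quadForm β c‖ ≤ (∑' m, A m) * ∑' k, ‖c k‖ ^ 2 := by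
  have hA0 : ∀ m, 0 ≤ A m := fun m => (norm_nonneg _).trans (hβ m 0)
  have hs := summable_quadForm_majorant hA hA0 hc
  calc ‖quadForm β c‖ ≤ ∑' p : (Fin d → ℤ) × (Fin d → ℤ), A p.1 * (‖c p.2‖ * ‖c (p.2 + p.1)‖) :=
        tsum_of_norm_bounded hs.hasSum (norm_quadForm_term_le hβ)
    _ = ∑' m, A m * ∑' k, ‖c k‖ * ‖c (k + m)‖ := by
        rw [hs.tsum_prod]
        simp only [tsum_mul_left]
    _ ≤ ∑' m, A m * ∑' k, ‖c k‖ ^ 2 := by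
        refine Summable.tsum_le_tsum
          (fun m => mul_le_mul_of_nonneg_left (tsum_norm_mul_norm_add_le hc m) (hA0 m)) ?_
          (hA.mul_right _)
        have := ((summable_prod_of_nonneg
          (fun p => mul_nonneg (hA0 _) (mul_nonneg (norm_nonneg _) (norm_nonneg _)))).mp hs).2
        simpa only [tsum_mul_left] using this
    _ = _ := tsum_mul_right

theorem quadForm_sub {β' : (Fin d → ℤ) → (Fin d → ℤ) → ℂ} {A' : (Fin d → ℤ) → ℝ}
    (hA : Summable A) (hβ : ∀ m k, ‖β m k‖ ≤ A m)
    (hA' : Summable A') (hβ' : ∀ m k, ‖β' m k‖ ≤ A' m) (hc : Summable fun k => ‖c k‖ ^ 2) :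
    quadForm β c - quadForm β' c = quadForm (fun m k => β m k - β' m k) c := by
  rw [quadForm, quadForm,
    ← (summable_quadForm hA hβ hc).tsum_sub (summable_quadForm hA' hβ' hc), quadForm]
  simp only [sub_mul]

/-- The matrix elements `⟨e_{k+m}, Op_h(a) e_k⟩` of the Weyl quantization. -/
def weylMatrix (h : ℝ) (a : TestFn d) (m k : Fin d → ℤ) : ℂ :=
  weylCoeff a m (fun i => h / 2 * ((k i : ℝ) + ((k + m) i : ℝ)))

theorem wigner_eq_quadForm (h : ℝ) (u : L2Torus d) (a : TestFn d) :
    wigner h u a = quadForm (weylMatrix h a) (torusCoeff u) := by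
  obtain ⟨A, hA, hAa⟩ := exists_summable_weylCoeff_bound a
  have hA0 : ∀ m, 0 ≤ A m := fun m => (norm_nonneg _).trans (hAa m 0)
  have hu := (hasSum_norm_sq_torusCoeff u).summable
  -- the part of `Op_h(a) u` that comes from the `m`-th off-diagonal
  have hT : ∀ m : Fin d → ℤ, ∃ v : L2Torus d, ‖v‖ ≤ A m * ‖u‖ ∧
      ∀ j, torusCoeff v j = weylMatrix h a m (j - m) * torusCoeff u (j - m) := by
    intro m
    have hs : HasSum (fun j => ‖torusCoeff u (j - m)‖ ^ 2) (‖u‖ ^ 2) :=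
      (Equiv.hasSum_iff (f := fun k => ‖torusCoeff u k‖ ^ 2) (Equiv.subRight m)).mpr
        (hasSum_norm_sq_torusCoeff u)
    have hle : ∀ j, ‖weylMatrix h a m (j - m) * torusCoeff u (j - m)‖ ^ 2
        ≤ A m ^ 2 * ‖torusCoeff u (j - m)‖ ^ 2 := fun j => by
      rw [norm_mul, mul_pow]
      exact mul_le_mul_of_nonneg_right (pow_le_pow_left₀ (norm_nonneg _) (hAa _ _) 2)
        (by positivity)
    obtain ⟨v, -, hv⟩ := exists_hasSum_expoL2 (d := d)
      (c := fun j => weylMatrix h a m (j - m) * torusCoeff u (j - m))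
      (Summable.of_nonneg_of_le (fun _ => by positivity) hle (hs.summable.mul_left _))
    refine ⟨v, ?_, hv⟩
    have h1 := hasSum_norm_sq_torusCoeff v
    simp only [hv] at h1
    have h2 := hasSum_le hle h1 (hs.mul_left _)
    rw [← mul_pow] at h2
    exact (pow_le_pow_iff_left₀ (norm_nonneg _) (mul_nonneg (hA0 m) (norm_nonneg _))
      two_ne_zero).mp h2
  choose T hTn hTc using hT
  have hTs : Summable T := Summable.of_norm_bounded (hA.mul_right ‖u‖) hTn
  have hweyl : weyl h a u = ∑' m, T m := by
    have hcoef : ∀ j : Fin d → ℤ, torusCoeff (∑' m, T m : L2Torus d) j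
        = ∑' k : Fin d → ℤ, (((2 * Real.pi) ^ ((d : ℝ) / 2) : ℝ) : ℂ)⁻¹
          * symbolCoeff a (j - k) (fun i => h / 2 * ((k i : ℝ) + (j i : ℝ))) * torusCoeff u k := by
      intro j
      rw [← inner_expoL2, ← innerSL_apply_apply ℂ, ContinuousLinearMap.map_tsum _ hTs,
        ← (Equiv.subLeft j).tsum_eq]
      refine tsum_congr fun k => ?_
      rw [innerSL_apply_apply, inner_expoL2, hTc]
      simp [weylMatrix, weylCoeff]
    have h1 := (expoBasis d).hasSum_repr (∑' m, T m)
    simp only [HilbertBasis.repr_apply_apply, coe_expoBasis, inner_expoL2, hcoef] at h1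
    exact h1.tsum_eq
  have hinner : ∀ m, inner ℂ u (T m)
      = ∑' k, weylMatrix h a m k * (torusCoeff u k * conj (torusCoeff u (k + m))) := by
    intro m
    have h1 := (expoBasis d).hasSum_inner_mul_inner u (T m)
    simp only [coe_expoBasis, inner_expoL2, hTc] at h1
    rw [← h1.tsum_eq, ← (Equiv.addRight m).tsum_eq]
    refine tsum_congr fun k => ?_
    rw [Equiv.coe_addRight, add_sub_cancel_right, ← inner_conj_symm, inner_expoL2]
    ring
  have hsum := summable_quadForm (β := weylMatrix h a) hA (fun m k => hAa m _) hu
  rw [wigner, hweyl, ← innerSL_apply_apply ℂ, ContinuousLinearMap.map_tsum _ hTs, quadForm,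
    hsum.tsum_prod]
  simp only [innerSL_apply_apply, hinner]

/-- Uniform boundedness of the Weyl quantization. -/
theorem exists_wigner_bound (a : TestFn d) :
    ∃ C, 0 ≤ C ∧ ∀ (h : ℝ) (u : L2Torus d), ‖wigner h u a‖ ≤ C * ‖u‖ ^ 2 := by
  obtain ⟨A, hA, hAa⟩ := exists_summable_weylCoeff_bound a
  refine ⟨∑' m, A m, tsum_nonneg fun m => (norm_nonneg _).trans (hAa m 0), fun h u => ?_⟩
  have hu := hasSum_norm_sq_torusCoeff u
  rw [wigner_eq_quadForm, ← hu.tsum_eq]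
  exact norm_quadForm_le hA (fun m k => hAa m _) hu.summable

theorem continuous_wigner_propagator (H : (Fin d → ℝ) → ℝ) (h : ℝ) (u : L2Torus d)
    (a : TestFn d) : Continuous fun t => wigner h (propagator H h t u) a := by
  obtain ⟨A, hA, hAa⟩ := exists_summable_weylCoeff_bound a
  have hu := (hasSum_norm_sq_torusCoeff u).summable
  simp only [wigner_eq_quadForm, quadForm]
  refine continuous_tsum (fun p => ?_) (summable_quadForm_majorant hA
    (fun m => (norm_nonneg _).trans (hAa m 0)) hu) fun p t => ?_
  · simp only [torusCoeff_propagator]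
    fun_prop
  · refine (norm_quadForm_term_le (fun m k => hAa m _) p).trans_eq ?_
    rw [norm_torusCoeff_propagator, norm_torusCoeff_propagator]

end QuadForm

/-! ### Averaging over windows of frequencies -/

section Windows

/-- The cube `{0, …, N - 1}ᵈ` of frequencies. -/
def window (d N : ℕ) : Finset (Fin d → ℤ) := Fintype.piFinset fun _ => Finset.Ico 0 (N : ℤ)

theorem mem_window {N : ℕ} {b : Fin d → ℤ} : b ∈ window d N ↔ ∀ i, 0 ≤ b i ∧ b i < N := by
  simp [window, Fintype.mem_piFinset]

theorem card_window (d N : ℕ) : (window d N).card = N ^ d := by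
  simp [window, Fintype.card_piFinset]

theorem card_window_filter {N : ℕ} {m : Fin d → ℤ} (hm : ∀ i, |m i| ≤ N) :
    (((window d N).filter fun b => b + m ∈ window d N).card : ℝ)
      = ∏ i, ((N : ℝ) - |(m i : ℝ)|) := by
  have h : (window d N).filter (fun b => b + m ∈ window d N)
      = Fintype.piFinset fun i => Finset.Ico (max 0 (-m i)) (min (N : ℤ) (N - m i)) := by
    ext b
    simp only [Finset.mem_filter, mem_window, Fintype.mem_piFinset, Finset.mem_Ico, ← forall_and,
      Pi.add_apply]
    refine forall_congr' fun i => ?_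
    omega
  rw [h, Fintype.card_piFinset, Nat.cast_prod]
  refine Finset.prod_congr rfl fun i _ => ?_
  have h1 : ((min (N : ℤ) (N - m i) - max 0 (-m i)).toNat : ℤ) = N - |m i| := by
    have := hm i
    rcases abs_cases (m i) with h | h <;> omega
  rw [Int.card_Ico]
  exact_mod_cast congrArg (fun z : ℤ => (z : ℝ)) h1

theorem tendsto_card_window_filter (m : Fin d → ℤ) :
    Tendsto (fun N : ℕ =>
      (((window d N).filter fun b => b + m ∈ window d N).card : ℝ) / (N : ℝ) ^ d)
      atTop (𝓝 1) := by
  have h1 : Tendsto (fun N : ℕ => ∏ i : Fin d, (1 - |(m i : ℝ)| / (N : ℝ))) atTop (𝓝 1) := by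
    have : Tendsto (fun N : ℕ => ∏ i : Fin d, (1 - |(m i : ℝ)| / (N : ℝ))) atTop
        (𝓝 (∏ _i : Fin d, (1 - 0))) := tendsto_finsetProd _ fun i _ =>
      tendsto_const_nhds.sub (tendsto_const_nhds.div_atTop tendsto_natCast_atTop_atTop)
    simpa using this
  refine h1.congr' ?_
  have h2 : ∀ i, ∀ᶠ N : ℕ in atTop, |m i| ≤ N := fun i => by
    filter_upwards [eventually_ge_atTop (m i).natAbs] with N hN
    rcases abs_cases (m i) with h | h <;> omega
  filter_upwards [eventually_all.mpr h2, eventually_gt_atTop 0] with N hN hN0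
  have hN' : (N : ℝ) ≠ 0 := by exact_mod_cast hN0.ne'
  rw [card_window_filter hN, ← Fin.prod_const, ← Finset.prod_div_distrib]
  refine Finset.prod_congr rfl fun i _ => ?_
  rw [sub_div, div_self hN']

/-- The matrix elements of the positive quantization obtained by averaging
`∑_b ∑_{b'} ⟨e_{j+b'}, a(x, hj) e_{j+b}⟩` over all translates `j + window` of the window. -/
def windowMatrix (h : ℝ) (N : ℕ) (a : TestFn d) (m k : Fin d → ℤ) : ℂ :=
  ((N : ℂ) ^ d)⁻¹ * ∑ b ∈ window d N, if b + m ∈ window d N then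
    weylCoeff a m (fun i => h * ((k - b) i : ℝ)) else 0

theorem norm_inv_pow_mul_sum_window_le {N : ℕ} {f : (Fin d → ℤ) → ℂ} {C : ℝ}
    (hN : 0 < N) (hf : ∀ b ∈ window d N, ‖f b‖ ≤ C) :
    ‖((N : ℂ) ^ d)⁻¹ * ∑ b ∈ window d N, f b‖ ≤ C := by
  have hN' : (0 : ℝ) < (N : ℝ) ^ d := by positivity
  rw [norm_mul, norm_inv, norm_pow, Complex.norm_natCast, inv_mul_le_iff₀ hN']
  refine (norm_sum_le_of_le _ hf).trans_eq ?_
  rw [Finset.sum_const, card_window, nsmul_eq_mul, Nat.cast_pow]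

theorem norm_windowMatrix_le {h : ℝ} {N : ℕ} {a : TestFn d} {A : (Fin d → ℤ) → ℝ} (hN : 0 < N)
    (hA : ∀ m ξ, ‖weylCoeff a m ξ‖ ≤ A m) (m k : Fin d → ℤ) :
    ‖windowMatrix h N a m k‖ ≤ A m :=
  norm_inv_pow_mul_sum_window_le hN fun b _ => by
    split_ifs
    · exact hA _ _
    · simpa using (norm_nonneg _).trans (hA m 0)

/-- The difference of the matrix elements on the `m`-th off-diagonal has two sources: the symbol is
evaluated at points at distance at most `h (|m| + N)`, and the pairs `(b, b + m)` that leave the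
window are missing. -/
theorem norm_weylMatrix_sub_windowMatrix_le {h : ℝ} {N : ℕ} {a : TestFn d}
    {A : (Fin d → ℤ) → ℝ} (hN : 0 < N) (hA : ∀ m ξ, ‖weylCoeff a m ξ‖ ≤ A m) {m : Fin d → ℤ}
    {ε δ : ℝ} (hε : 0 ≤ ε)
    (hδ : ∀ ξ η : Fin d → ℝ, dist ξ η < δ → dist (weylCoeff a m ξ) (weylCoeff a m η) ≤ ε)
    (hh : |h| * (‖m‖ + N) < δ) (k : Fin d → ℤ) :
    ‖weylMatrix h a m k - windowMatrix h N a m k‖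
      ≤ ε + A m * (1 - (((window d N).filter fun b => b + m ∈ window d N).card : ℝ)
        / (N : ℝ) ^ d) := by
  have hN' : (0 : ℝ) < (N : ℝ) ^ d := by positivity
  have hNc : ((N : ℂ) ^ d) ≠ 0 := pow_ne_zero _ (by exact_mod_cast hN.ne')
  have hA0 : 0 ≤ A m := (norm_nonneg _).trans (hA m 0)
  have h1 : weylMatrix h a m k = ((N : ℂ) ^ d)⁻¹ * ∑ _b ∈ window d N, weylMatrix h a m k := by
    rw [Finset.sum_const, card_window, nsmul_eq_mul, Nat.cast_pow, inv_mul_cancel_left₀ hNc]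
  have h2 : ∀ b ∈ window d N, ‖weylMatrix h a m k - (if b + m ∈ window d N then
      weylCoeff a m (fun i => h * ((k - b) i : ℝ)) else 0)‖
      ≤ ε + A m * (if b + m ∈ window d N then 0 else 1) := by
    intro b hb
    split_ifs with hbm
    · rw [mul_zero, add_zero, ← dist_eq_norm]
      refine hδ _ _ (lt_of_le_of_lt ?_ hh)
      refine (dist_pi_le_iff (by positivity)).mpr fun i => ?_
      have h3 : h / 2 * ((k i : ℝ) + ((k + m) i : ℝ)) - h * ((k - b) i : ℝ)
          = h * ((m i : ℝ) / 2 + b i) := by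
        simp only [Pi.add_apply, Pi.sub_apply]
        push_cast
        ring
      rw [Real.dist_eq, h3, abs_mul]
      refine mul_le_mul_of_nonneg_left ?_ (abs_nonneg h)
      have h4 : |(m i : ℝ)| ≤ ‖m‖ := by
        simpa only [Int.norm_eq_abs] using norm_le_pi_norm m i
      have h5 : |(b i : ℝ)| ≤ N := by
        obtain ⟨h6, h7⟩ := mem_window.mp hb i
        rw [abs_of_nonneg (by exact_mod_cast h6)]
        exact_mod_cast h7.le
      refine (abs_add_le _ _).trans (add_le_add ?_ h5)
      rw [abs_div, abs_two]
      linarith [abs_nonneg (m i : ℝ)]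
    · rw [sub_zero, mul_one]
      exact (hA _ _).trans (by linarith)
  rw [h1, windowMatrix, ← mul_sub, ← Finset.sum_sub_distrib, norm_mul, norm_inv, norm_pow,
    Complex.norm_natCast, inv_mul_le_iff₀ hN']
  refine (norm_sum_le_of_le _ h2).trans_eq ?_
  rw [Finset.sum_add_distrib, Finset.sum_const, card_window, nsmul_eq_mul, Nat.cast_pow,
    ← Finset.mul_sum]
  have h3 : ∑ b ∈ window d N, (if b + m ∈ window d N then (0 : ℝ) else 1)
      = (N : ℝ) ^ d - (((window d N).filter fun b => b + m ∈ window d N).card : ℝ) := by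
    have h4 : ∑ b ∈ window d N, (if b + m ∈ window d N then (0 : ℝ) else 1)
        = ∑ b ∈ window d N, (1 - if b + m ∈ window d N then (1 : ℝ) else 0) :=
      Finset.sum_congr rfl fun b _ => by split_ifs <;> norm_num
    rw [h4, Finset.sum_sub_distrib, Finset.sum_const, card_window, Finset.sum_boole]
    simp
  rw [h3]
  field_simp

/-- The Weyl quantization and the averaged quantization agree asymptotically, when the window is
large on the lattice `ℤᵈ` but small at the scale `1/h`. -/
theorem exists_tendsto_quadForm_sub (a : TestFn d) {h : ℕ → ℝ} {N : ℕ → ℕ}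
    (hh : Tendsto h atTop (𝓝 0)) (hN0 : ∀ n, 0 < N n) (hN : Tendsto N atTop atTop)
    (hhN : Tendsto (fun n => h n * N n) atTop (𝓝 0)) :
    ∃ ε : ℕ → ℝ, Tendsto ε atTop (𝓝 0) ∧ ∀ n (c : (Fin d → ℤ) → ℂ),
      Summable (fun k => ‖c k‖ ^ 2) →
      ‖quadForm (weylMatrix (h n) a) c - quadForm (windowMatrix (h n) (N n) a) c‖
        ≤ ε n * ∑' k, ‖c k‖ ^ 2 := by
  obtain ⟨A, hA, hAa⟩ := exists_summable_weylCoeff_bound a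
  have hle : ∀ n m k, ‖weylMatrix (h n) a m k - windowMatrix (h n) (N n) a m k‖ ≤ 2 * A m :=
    fun n m k => (norm_sub_le _ _).trans (by
      have h1 := norm_windowMatrix_le (h := h n) (hN0 n) hAa m k
      have h2 : ‖weylMatrix (h n) a m k‖ ≤ A m := hAa _ _
      linarith)
  set E : ℕ → (Fin d → ℤ) → ℝ := fun n m =>
    ⨆ k, ‖weylMatrix (h n) a m k - windowMatrix (h n) (N n) a m k‖ with hE
  have hEbdd : ∀ n m, BddAbove (range fun k =>
      ‖weylMatrix (h n) a m k - windowMatrix (h n) (N n) a m k‖) := fun n m =>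
    ⟨2 * A m, by rintro _ ⟨k, rfl⟩; exact hle n m k⟩
  have hE0 : ∀ n m, 0 ≤ E n m := fun n m => Real.iSup_nonneg fun k => norm_nonneg _
  have hEle : ∀ n m, E n m ≤ 2 * A m := fun n m => ciSup_le fun k => hle n m k
  have hEs : ∀ n, Summable (E n) := fun n =>
    Summable.of_nonneg_of_le (hE0 n) (hEle n) (hA.mul_left 2)
  refine ⟨fun n => ∑' m, E n m, ?_, fun n c hc => ?_⟩
  · have hlim : ∀ m, Tendsto (fun n => E n m) atTop (𝓝 0) := by
      intro m
      have hA0 : 0 ≤ A m := (norm_nonneg _).trans (hAa m 0)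
      rw [Metric.tendsto_nhds]
      intro ε hε
      obtain ⟨δ, hδ0, hδ⟩ := Metric.uniformContinuous_iff.mp (uniformContinuous_weylCoeff a m)
        (ε / 4) (by positivity)
      have h1 : Tendsto (fun n => |h n| * (‖m‖ + N n)) atTop (𝓝 0) := by
        have := (hh.abs.mul_const ‖m‖).add hhN.abs
        simp only [abs_zero, zero_mul, add_zero] at this
        refine this.congr fun n => ?_
        rw [abs_mul, Nat.abs_cast]
        ring
      have h2 : Tendsto (fun n => A m * (1 - (((window d (N n)).filter
          fun b => b + m ∈ window d (N n)).card : ℝ) / (N n : ℝ) ^ d)) atTop (𝓝 0) := by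
        have := ((tendsto_card_window_filter m).comp hN).const_sub 1 |>.const_mul (A m)
        simpa using this
      filter_upwards [h1.eventually_lt_const hδ0,
        h2.eventually_lt_const (show (0 : ℝ) < ε / 4 by positivity)] with n hn1 hn2
      rw [Real.dist_eq, sub_zero, abs_of_nonneg (hE0 n m)]
      refine lt_of_le_of_lt (ciSup_le fun k => (norm_weylMatrix_sub_windowMatrix_le (hN0 n) hAa
        (ε := ε / 4) (by positivity) (fun ξ η hd => (hδ hd).le) hn1 k)) ?_
      linarith
    have := tendsto_tsum_of_dominated_convergence (𝓕 := atTop) (f := fun n m => E n m)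
      (g := fun _ => 0) (hA.mul_left 2) hlim (Eventually.of_forall fun n m => by
        rw [Real.norm_of_nonneg (hE0 n m)]; exact hEle n m)
    simpa using this
  · rw [quadForm_sub (β := weylMatrix (h n) a) hA (fun m k => hAa m _) hA (fun m k => norm_windowMatrix_le (hN0 n) hAa m k) hc]
    exact norm_quadForm_le (hEs n) (fun m k => le_ciSup (hEbdd n m) k) hc

/-- The averaged quantization as a sum over the translates of the window. -/
theorem hasSum_window (a : TestFn d) (h : ℝ) (N : ℕ) {c : (Fin d → ℤ) → ℂ}
    (hc : Summable fun k => ‖c k‖ ^ 2) :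
    HasSum (fun j : Fin d → ℤ => ((N : ℂ) ^ d)⁻¹ * ∑ b ∈ window d N, ∑ b' ∈ window d N,
      weylCoeff a (b' - b) (fun i => h * (j i : ℝ)) * (c (j + b) * conj (c (j + b'))))
      (quadForm (windowMatrix h N a) c) := by
  obtain ⟨A, hA, hAa⟩ := exists_summable_weylCoeff_bound a
  have hA0 : ∀ m, 0 ≤ A m := fun m => (norm_nonneg _).trans (hAa m 0)
  -- the contribution of a fixed first frequency `b` of the window, as a quadratic form
  set β : (Fin d → ℤ) → (Fin d → ℤ) → (Fin d → ℤ) → ℂ := fun b m k =>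
    if b + m ∈ window d N then weylCoeff a m (fun i => h * ((k - b) i : ℝ)) else 0 with hβ
  have hβA : ∀ b m k, ‖β b m k‖ ≤ A m := fun b m k => by
    simp only [hβ]
    split_ifs
    · exact hAa _ _
    · simpa using hA0 m
  have h1 : quadForm (windowMatrix h N a) c
      = ((N : ℂ) ^ d)⁻¹ * ∑ b ∈ window d N, quadForm (β b) c := by
    simp only [quadForm]
    rw [← Summable.tsum_finsetSum (fun b _ => summable_quadForm hA (hβA b) hc), ← tsum_mul_left]
    refine tsum_congr fun p => ?_
    rw [windowMatrix, ← Finset.sum_mul, mul_assoc]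
  rw [h1]
  refine HasSum.mul_left _ (hasSum_sum fun b hb => ?_)
  have h2 : HasSum (fun k => ∑' m, β b m k * (c k * conj (c (k + m)))) (quadForm (β b) c) := by
    have hs := summable_quadForm hA (hβA b) hc
    have hs' := hs.prod_symm
    have := hs'.hasSum.prod_fiberwise fun k => (hs'.prod_factor k).hasSum
    rwa [← (Equiv.prodComm _ _).tsum_eq] at this
  have h3 := (Equiv.hasSum_iff (f := fun k => ∑' m, β b m k * (c k * conj (c (k + m))))
    (Equiv.addRight b)).mpr h2
  refine h3.congr_fun fun j => ?_
  simp only [Function.comp_apply, Equiv.coe_addRight]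
  rw [← (Equiv.subRight b).tsum_eq, tsum_eq_sum (s := window d N)]
  · refine Finset.sum_congr rfl fun b' hb' => ?_
    simp only [hβ, Equiv.subRight_apply, add_sub_cancel, hb', if_true, add_sub_cancel_right,
      add_assoc]
  · intro b' hb'
    simp only [hβ, Equiv.subRight_apply, add_sub_cancel, hb', if_false, zero_mul]

end Windows

/-! ### Husimi measures -/

section Husimi

/-- The density at `(x, j)` of the discrete Husimi measure of a family `c` of Fourier coefficients:
the squared modulus of the part of `∑ c_k e_k` with frequencies in `j + window`, normalised. -/
def husimiDensity (N : ℕ) (c : (Fin d → ℤ) → ℂ) (x : Torus d) (j : Fin d → ℤ) : ℝ :=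
  ((N : ℝ) ^ d)⁻¹ * ‖∑ b ∈ window d N, c (j + b) * expo (j + b) x‖ ^ 2

theorem husimiDensity_nonneg (N : ℕ) (c : (Fin d → ℤ) → ℂ) (x : Torus d) (j : Fin d → ℤ) :
    0 ≤ husimiDensity N c x j := by
  unfold husimiDensity
  positivity

theorem continuous_husimiDensity (N : ℕ) {c : ℝ → (Fin d → ℤ) → ℂ}
    (hc : ∀ k, Continuous fun t => c t k) :
    Continuous fun y : ℝ × Torus d × (Fin d → ℤ) => husimiDensity N (c y.1) y.2.1 y.2.2 := by
  have h : ∀ j, Continuous fun y : ℝ × Torus d => husimiDensity N (c y.1) y.2 j := fun j => by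
    unfold husimiDensity
    have h1 : ∀ k, Continuous fun y : ℝ × Torus d => c y.1 k * expo k y.2 := fun k =>
      ((hc k).comp continuous_fst).mul ((expo k).continuous.comp continuous_snd)
    exact continuous_const.mul ((continuous_finsetSum _ fun b _ => h1 _).norm.pow 2)
  have h2 : Continuous fun z : (Fin d → ℤ) × ℝ × Torus d => husimiDensity N (c z.2.1) z.2.2 z.1 :=
    continuous_prod_of_discrete_left.mpr h
  exact h2.comp (f := fun y : ℝ × Torus d × (Fin d → ℤ) => (y.2.2, y.1, y.2.1)) (by fun_prop)

/-- Expanding the square in the Husimi density, `e_{j+b} conj(e_{j+b'})` is a multiple of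
`conj(e_{b'-b})`, which picks out a Fourier coefficient of `f`. -/
theorem integral_mul_husimiDensity {f : Torus d → ℂ} (hf : Continuous f) (N : ℕ)
    (c : (Fin d → ℤ) → ℂ) (j : Fin d → ℤ) :
    ∫ x, f x * (husimiDensity N c x j : ℂ) = ((N : ℂ) ^ d)⁻¹ *
      ∑ b ∈ window d N, ∑ b' ∈ window d N,
        ((((2 * Real.pi) ^ ((d : ℝ) / 2) : ℝ) : ℂ)⁻¹ * torusCoeff f (b' - b))
          * (c (j + b) * conj (c (j + b'))) := by
  have hpt : ∀ x, f x * (husimiDensity N c x j : ℂ) = ((N : ℂ) ^ d)⁻¹ *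
      ∑ b ∈ window d N, ∑ b' ∈ window d N,
        ((((2 * Real.pi) ^ ((d : ℝ) / 2) : ℝ) : ℂ)⁻¹ * (f x * conj (expo (b' - b) x)))
          * (c (j + b) * conj (c (j + b'))) := by
    intro x
    have h1 : ∀ b b', expo (j + b) x * conj (expo (j + b') x)
        = (((2 * Real.pi) ^ ((d : ℝ) / 2) : ℝ) : ℂ)⁻¹ * conj (expo (b' - b) x) := fun b b' => by
      rw [conj_expo, conj_expo, expo_mul_expo]
      congr 3
      abel
    have h2 : ((‖∑ b ∈ window d N, c (j + b) * expo (j + b) x‖ ^ 2 : ℝ) : ℂ)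
        = ∑ b ∈ window d N, ∑ b' ∈ window d N,
          (c (j + b) * expo (j + b) x) * conj (c (j + b') * expo (j + b') x) := by
      rw [← Finset.sum_mul_sum, ← map_sum, RCLike.mul_conj]
      norm_cast
    rw [husimiDensity, Complex.ofReal_mul, h2, mul_left_comm, Finset.mul_sum]
    push_cast
    congr 1
    refine Finset.sum_congr rfl fun b _ => ?_
    rw [Finset.mul_sum]
    refine Finset.sum_congr rfl fun b' _ => ?_
    rw [map_mul, show c (j + b) * expo (j + b) x * (conj (c (j + b')) * conj (expo (j + b') x))
      = (expo (j + b) x * conj (expo (j + b') x)) * (c (j + b) * conj (c (j + b'))) by ring, h1]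
    ring
  simp only [hpt]
  have hi : ∀ m, Integrable (fun x => f x * conj (expo m x)) (volume : Measure (Torus d)) :=
    fun m => (hf.mul (Complex.continuous_conj.comp (expo m).continuous)).integrable_of_hasCompactSupport
      (HasCompactSupport.of_compactSpace _)
  rw [integral_const_mul, integral_finsetSum _ fun b _ => integrable_finsetSum _ fun b' _ =>
    ((hi _).const_mul _).mul_const _]
  congr 1
  refine Finset.sum_congr rfl fun b _ => ?_
  rw [integral_finsetSum _ fun b' _ => ((hi _).const_mul _).mul_const _]
  refine Finset.sum_congr rfl fun b' _ => ?_
  rw [integral_mul_const, integral_const_mul, torusCoeff]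

theorem integral_husimiDensity (N : ℕ) (c : (Fin d → ℤ) → ℂ) (j : Fin d → ℤ) :
    ∫ x, husimiDensity N c x j = ((N : ℝ) ^ d)⁻¹ * ∑ b ∈ window d N, ‖c (j + b)‖ ^ 2 := by
  have h := integral_mul_husimiDensity (f := fun _ => 1) continuous_const N c j
  have h1 : ∀ m : Fin d → ℤ, torusCoeff (fun _ => 1) m
      = if m = 0 then (((2 * Real.pi) ^ ((d : ℝ) / 2) : ℝ) : ℂ) else 0 := fun m => by
    simp only [torusCoeff, one_mul, conj_expo, integral_expo, neg_eq_zero]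
  have hne : (((2 * Real.pi) ^ ((d : ℝ) / 2) : ℝ) : ℂ) ≠ 0 := by
    exact_mod_cast (two_pi_rpow_pos d).ne'
  have h2 : ∀ b ∈ window d N, ∑ b' ∈ window d N,
      ((((2 * Real.pi) ^ ((d : ℝ) / 2) : ℝ) : ℂ)⁻¹ * torusCoeff (fun _ => 1) (b' - b))
        * (c (j + b) * conj (c (j + b'))) = ((‖c (j + b)‖ ^ 2 : ℝ) : ℂ) := by
    intro b hb
    rw [Finset.sum_eq_single_of_mem b hb]
    · rw [h1, if_pos (sub_self b), inv_mul_cancel₀ hne, one_mul, RCLike.mul_conj]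
      norm_cast
    · intro b' _ hbb
      rw [h1, if_neg (sub_ne_zero.mpr hbb), mul_zero, zero_mul]
  rw [Finset.sum_congr rfl h2] at h
  simp only [one_mul] at h
  rw [integral_complex_ofReal] at h
  refine Complex.ofReal_injective (h.trans ?_)
  push_cast
  rfl

/-- The Husimi density of a normalised family has mass one: each `‖c_k‖²` is counted once for each
of the `Nᵈ` translates of the window that contain `k`. -/
theorem lintegral_husimiDensity {N : ℕ} (hN : 0 < N) {c : (Fin d → ℤ) → ℂ}
    (hc : HasSum (fun k => ‖c k‖ ^ 2) 1) :
    ∫⁻ y : Torus d × (Fin d → ℤ), ENNReal.ofReal (husimiDensity N c y.1 y.2)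
      ∂((volume : Measure (Torus d)).prod Measure.count) = 1 := by
  have hcont : Continuous fun y : Torus d × (Fin d → ℤ) => husimiDensity N c y.1 y.2 :=
    (continuous_husimiDensity N (c := fun _ => c) fun _ => continuous_const).comp
      (f := fun y : Torus d × (Fin d → ℤ) => ((0 : ℝ), y)) (by fun_prop)
  have hN' : ((N : ℝ) ^ d) ≠ 0 := by positivity
  have hs : HasSum (fun j => ((N : ℝ) ^ d)⁻¹ * ∑ b ∈ window d N, ‖c (j + b)‖ ^ 2) 1 := by
    have h1 : HasSum (fun j => ∑ b ∈ window d N, ‖c (j + b)‖ ^ 2) (∑ _b ∈ window d N, (1 : ℝ)) :=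
      hasSum_sum fun b _ => by
        have := hasSum_norm_sq_add hc.summable b
        rwa [hc.tsum_eq] at this
    have h2 := h1.mul_left ((N : ℝ) ^ d)⁻¹
    rwa [Finset.sum_const, card_window, nsmul_eq_mul, mul_one, Nat.cast_pow,
      inv_mul_cancel₀ hN'] at h2
  rw [lintegral_prod_symm _ (by fun_prop), lintegral_count]
  have h1 : ∀ j, ∫⁻ x, ENNReal.ofReal (husimiDensity N c x j)
      = ENNReal.ofReal (((N : ℝ) ^ d)⁻¹ * ∑ b ∈ window d N, ‖c (j + b)‖ ^ 2) := by
    intro j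
    rw [← integral_husimiDensity, ofReal_integral_eq_lintegral_ofReal]
    · exact (hcont.comp (f := fun x : Torus d => (x, j)) (by fun_prop)).integrable_of_hasCompactSupport
        (HasCompactSupport.of_compactSpace _)
    · exact Eventually.of_forall fun x => husimiDensity_nonneg N c x j
  simp only [h1]
  rw [← ENNReal.ofReal_tsum_of_nonneg (fun j => by positivity) hs.summable, hs.tsum_eq,
    ENNReal.ofReal_one]

/-- Testing a symbol against the Husimi density gives the averaged quantization. -/
theorem integral_husimiDensity_smul {N : ℕ} (hN : 0 < N) {c : (Fin d → ℤ) → ℂ}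
    (hc : HasSum (fun k => ‖c k‖ ^ 2) 1) (h : ℝ) (a : TestFn d) :
    ∫ y : Torus d × (Fin d → ℤ), (ENNReal.ofReal (husimiDensity N c y.1 y.2)).toReal •
        a (y.1, fun i => h * (y.2 i : ℝ)) ∂((volume : Measure (Torus d)).prod Measure.count)
      = quadForm (windowMatrix h N a) c := by
  have hcont : Continuous fun y : Torus d × (Fin d → ℤ) => husimiDensity N c y.1 y.2 :=
    (continuous_husimiDensity N (c := fun _ => c) fun _ => continuous_const).comp
      (f := fun y : Torus d × (Fin d → ℤ) => ((0 : ℝ), y)) (by fun_prop)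
  have hacont : Continuous fun y : Torus d × (Fin d → ℤ) => a (y.1, fun i => h * (y.2 i : ℝ)) :=
    a.continuous.comp (by fun_prop)
  obtain ⟨C, _, hC⟩ := a.exists_bound
  have hint : Integrable (fun y : Torus d × (Fin d → ℤ) =>
      (ENNReal.ofReal (husimiDensity N c y.1 y.2)).toReal • a (y.1, fun i => h * (y.2 i : ℝ)))
      ((volume : Measure (Torus d)).prod Measure.count) := by
    have hfin : IsFiniteMeasure (((volume : Measure (Torus d)).prod Measure.count).withDensity
        fun y : Torus d × (Fin d → ℤ) => ENNReal.ofReal (husimiDensity N c y.1 y.2)) :=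
      isFiniteMeasure_withDensity (by rw [lintegral_husimiDensity hN hc]; simp)
    rw [← integrable_withDensity_iff_integrable_smul' (by fun_prop)
      (Eventually.of_forall fun _ => ENNReal.ofReal_lt_top)]
    exact Integrable.of_bound hacont.aestronglyMeasurable C (Eventually.of_forall fun y => hC _)
  rw [integral_prod_symm _ hint, integral_countable hint.integral_prod_right,
    ← (hasSum_window a h N hc.summable).tsum_eq]
  refine tsum_congr fun j => ?_
  have h1 := integral_mul_husimiDensity (f := fun x => a (x, fun i => h * (j i : ℝ)))
    (a.continuous.comp (by fun_prop)) N c j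
  rw [Measure.real, Measure.count_singleton, ENNReal.toReal_one, one_smul]
  simp only [weylCoeff, symbolCoeff]
  rw [← h1]
  refine integral_congr_ae (Eventually.of_forall fun x => ?_)
  simp only [ENNReal.toReal_ofReal (husimiDensity_nonneg N c x j), Complex.real_smul, mul_comm]

variable (γ : Measure ℝ)

/-- The Husimi measure on `ℝ × T*𝕋ᵈ` of a family `t ↦ c t` of Fourier coefficients, with time
weighted by `γ`. -/
def husimi (h : ℝ) (N : ℕ) (c : ℝ → (Fin d → ℤ) → ℂ) : Measure (ℝ × Phase d) :=
  ((γ.prod ((volume : Measure (Torus d)).prod Measure.count)).withDensity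
    fun y => ENNReal.ofReal (husimiDensity N (c y.1) y.2.1 y.2.2)).map
    fun y => (y.1, (y.2.1, fun i => h * (y.2.2 i : ℝ)))

variable {γ} {c : ℝ → (Fin d → ℤ) → ℂ} {N : ℕ}

theorem measurable_husimi_map (h : ℝ) : Measurable
    fun y : ℝ × Torus d × (Fin d → ℤ) => ((y.1, (y.2.1, fun i => h * (y.2.2 i : ℝ))) : ℝ × Phase d) := by
  have : Continuous fun y : ℝ × Torus d × (Fin d → ℤ) =>
    ((y.1, (y.2.1, fun i => h * (y.2.2 i : ℝ))) : ℝ × Phase d) := by fun_prop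
  exact this.measurable

/-- The time marginal of the Husimi measure is the weight `γ`. -/
theorem husimi_map_fst [SFinite γ] (hN : 0 < N) (hc : ∀ k, Continuous fun t => c t k)
    (hc1 : ∀ t, HasSum (fun k => ‖c t k‖ ^ 2) 1) (h : ℝ) :
    (husimi γ h N c).map Prod.fst = γ := by
  have hm : Measurable fun y : ℝ × Torus d × (Fin d → ℤ) =>
      ENNReal.ofReal (husimiDensity N (c y.1) y.2.1 y.2.2) :=
    (continuous_husimiDensity N hc).measurable.ennreal_ofReal
  ext A hA
  rw [husimi, Measure.map_map measurable_fst (measurable_husimi_map h),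
    Measure.map_apply (measurable_fst.comp (measurable_husimi_map h)) hA]
  have h1 : (Prod.fst ∘ fun y : ℝ × Torus d × (Fin d → ℤ) =>
      ((y.1, (y.2.1, fun i => h * (y.2.2 i : ℝ))) : ℝ × Phase d)) ⁻¹' A = A ×ˢ univ := by
    ext y
    simp
  rw [h1, withDensity_apply _ (hA.prod MeasurableSet.univ), ← Measure.prod_restrict,
    lintegral_prod _ hm.aemeasurable, Measure.restrict_univ]
  simp only [lintegral_husimiDensity hN (hc1 _)]
  simp

theorem isProbabilityMeasure_husimi [IsProbabilityMeasure γ] (hN : 0 < N)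
    (hc : ∀ k, Continuous fun t => c t k) (hc1 : ∀ t, HasSum (fun k => ‖c t k‖ ^ 2) 1) (h : ℝ) :
    IsProbabilityMeasure (husimi γ h N c) := by
  have h1 := husimi_map_fst (γ := γ) hN hc hc1 h
  constructor
  rw [← preimage_univ (f := (Prod.fst : ℝ × Phase d → ℝ)),
    ← Measure.map_apply measurable_fst MeasurableSet.univ, h1, measure_univ]

/-- Testing a symbol against the Husimi measure gives the averaged quantization, integrated in
time. -/
theorem integral_husimi [IsProbabilityMeasure γ] (hN : 0 < N)
    (hc : ∀ k, Continuous fun t => c t k) (hc1 : ∀ t, HasSum (fun k => ‖c t k‖ ^ 2) 1) (h : ℝ)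
    {ψ : ℝ → ℂ} (hψ : Continuous ψ) {B : ℝ} (hB : ∀ t, ‖ψ t‖ ≤ B) (a : TestFn d) :
    ∫ y, ψ y.1 * a y.2 ∂(husimi γ h N c)
      = ∫ t, ψ t * quadForm (windowMatrix h N a) (c t) ∂γ := by
  have hm : Measurable fun y : ℝ × Torus d × (Fin d → ℤ) =>
      ENNReal.ofReal (husimiDensity N (c y.1) y.2.1 y.2.2) :=
    (continuous_husimiDensity N hc).measurable.ennreal_ofReal
  have hcont : Continuous fun y : ℝ × Phase d => ψ y.1 * a y.2 :=
    (hψ.comp continuous_fst).mul (a.continuous.comp continuous_snd)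
  have hprob := isProbabilityMeasure_husimi (γ := γ) hN hc hc1 h
  obtain ⟨C, _, hC⟩ := a.exists_bound
  have hB0 : 0 ≤ B := (norm_nonneg _).trans (hB 0)
  have hint : Integrable (fun y => ψ y.1 * a y.2) (husimi γ h N c) :=
    Integrable.of_bound hcont.aestronglyMeasurable (B * C) (Eventually.of_forall fun y => by
      rw [norm_mul]
      exact mul_le_mul (hB _) (hC _) (norm_nonneg _) hB0)
  rw [husimi] at hint ⊢
  rw [integral_map (measurable_husimi_map h).aemeasurable hcont.aestronglyMeasurable,
    integral_withDensity_eq_integral_toReal_smul hm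
      (Eventually.of_forall fun _ => ENNReal.ofReal_lt_top)]
  rw [integrable_map_measure hcont.aestronglyMeasurable (measurable_husimi_map h).aemeasurable,
    integrable_withDensity_iff_integrable_smul' hm
      (Eventually.of_forall fun _ => ENNReal.ofReal_lt_top)] at hint
  have h2 := integral_prod _ hint
  simp only [Function.comp_apply] at h2
  rw [h2]
  refine integral_congr_ae (Eventually.of_forall fun t => ?_)
  simp only [← mul_smul_comm]
  rw [integral_const_mul, integral_husimiDensity_smul hN (hc1 t)]

end Husimi

/-! ### Compactness of families of measures on space-time -/

section Compactness

/-- Extension by zero along an open embedding preserves continuity of compactly supported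
functions. -/
theorem continuous_extend_of_isOpenEmbedding {X Y E : Type*} [TopologicalSpace X]
    [TopologicalSpace Y] [T2Space Y] [TopologicalSpace E] [Zero E] {i : X → Y}
    (hi : IsOpenEmbedding i) {f : X → E} (hf : Continuous f) (hc : HasCompactSupport f) :
    Continuous (Function.extend i f 0) := by
  rw [continuous_iff_continuousAt]
  intro y
  by_cases hy : y ∈ range i
  · obtain ⟨x, rfl⟩ := hy
    rw [← hi.continuousAt_iff, Function.extend_comp hi.injective]
    exact hf.continuousAt
  · have hK : IsClosed (i '' tsupport f) := (hc.isCompact.image hi.continuous).isClosed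
    have h0 : ∀ z ∈ (i '' tsupport f)ᶜ, Function.extend i f 0 z = 0 := by
      intro z hz
      by_cases hzr : z ∈ range i
      · obtain ⟨x, rfl⟩ := hzr
        rw [hi.injective.extend_apply]
        exact image_eq_zero_of_notMem_tsupport fun hx => hz ⟨x, hx, rfl⟩
      · rw [Function.extend_apply' _ _ _ hzr, Pi.zero_apply]
    have hyn : y ∈ (i '' tsupport f)ᶜ := fun ⟨x, _, hx⟩ => hy ⟨x, hx⟩
    have hev : Function.extend i f 0 =ᶠ[𝓝 y] fun _ => 0 := by
      filter_upwards [hK.isOpen_compl.mem_nhds hyn] with z hz using h0 z hz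
    exact continuousAt_const.congr hev.symm

/-- The compactification `[-∞, ∞] × 𝕋ᵈ × [-∞, ∞]ᵈ` of space-time `ℝ × T*𝕋ᵈ`. -/
abbrev CompactSpacetime (d : ℕ) : Type := EReal × Torus d × (Fin d → EReal)

/-- The inclusion of space-time into its compactification. -/
def toCompact (d : ℕ) : ℝ × Phase d → CompactSpacetime d :=
  Prod.map Real.toEReal (Prod.map id (Pi.map fun _ => Real.toEReal))

theorem isOpenEmbedding_toCompact : IsOpenEmbedding (toCompact d) :=
  EReal.isOpenEmbedding_coe.prodMap
    (IsOpenEmbedding.id.prodMap (IsOpenEmbedding.piMap fun _ => EReal.isOpenEmbedding_coe))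

/-- Probability measures on space-time with time marginal `γ` have vague limit points, and mass
may only escape to infinity in `ξ`. -/
theorem exists_subseq_tendsto_integral {γ : Measure ℝ} [IsProbabilityMeasure γ]
    {ν : ℕ → Measure (ℝ × Phase d)} (hp : ∀ n, IsProbabilityMeasure (ν n))
    (hγ : ∀ n, (ν n).map Prod.fst = γ) :
    ∃ (κ : ℕ → ℕ) (ρ : Measure (ℝ × Phase d)), StrictMono κ ∧ IsFiniteMeasure ρ ∧ ρ.fst ≤ γ ∧
      ∀ f : ℝ × Phase d → ℂ, Continuous f → HasCompactSupport f →
        Tendsto (fun n => ∫ y, f y ∂(ν (κ n))) atTop (𝓝 (∫ y, f y ∂ρ)) := by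
  have hι := isOpenEmbedding_toCompact (d := d)
  have hm := hι.measurableEmbedding
  let νc : ℕ → ProbabilityMeasure (CompactSpacetime d) := fun n =>
    ⟨(ν n).map (toCompact d), Measure.isProbabilityMeasure_map hm.measurable.aemeasurable⟩
  obtain ⟨ρc, -, κ, hκ, hlim⟩ := isCompact_univ.tendsto_subseq (x := νc) fun n => mem_univ _
  have hfst : ((ρc : Measure (CompactSpacetime d))).map Prod.fst = γ.map Real.toEReal := by
    have h1 := ProbabilityMeasure.tendsto_map_of_tendsto_of_continuous _ _ hlim
      (f := (Prod.fst : CompactSpacetime d → EReal)) continuous_fst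
    let γc : ProbabilityMeasure EReal :=
      ⟨γ.map Real.toEReal, Measure.isProbabilityMeasure_map measurable_coe_real_ereal.aemeasurable⟩
    have h2 : ∀ n, ((νc ∘ κ) n).map (f := (Prod.fst : CompactSpacetime d → EReal))
        continuous_fst.measurable.aemeasurable = γc := by
      intro n
      refine Subtype.ext ?_
      change ((ν (κ n)).map (toCompact d)).map Prod.fst = γ.map Real.toEReal
      rw [Measure.map_map measurable_fst hm.measurable, ← hγ (κ n),
        Measure.map_map measurable_coe_real_ereal measurable_fst]
      rfl
    have h3 := tendsto_nhds_unique (h1.congr h2) tendsto_const_nhds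
    exact congrArg Subtype.val h3
  refine ⟨κ, (ρc : Measure (CompactSpacetime d)).comap (toCompact d), hκ, ?_, ?_, ?_⟩
  · constructor
    rw [hm.comap_apply]
    exact measure_lt_top _ _
  · refine Measure.le_iff.mpr fun A hA => ?_
    rw [Measure.fst_apply hA, hm.comap_apply]
    calc (ρc : Measure (CompactSpacetime d)) (toCompact d '' (Prod.fst ⁻¹' A))
        ≤ (ρc : Measure (CompactSpacetime d)) (Prod.fst ⁻¹' (Real.toEReal '' A)) := by
          refine measure_mono ?_
          rintro _ ⟨y, hy, rfl⟩
          exact ⟨y.1, hy, rfl⟩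
      _ = γ A := by
          have hA' : MeasurableSet (Real.toEReal '' A) :=
            EReal.isOpenEmbedding_coe.measurableEmbedding.measurableSet_image.mpr hA
          rw [← Measure.map_apply measurable_fst hA', hfst,
            Measure.map_apply measurable_coe_real_ereal hA',
            EReal.isOpenEmbedding_coe.injective.preimage_image]
  · intro f hf hc
    have hF := continuous_extend_of_isOpenEmbedding hι hf hc
    let F : BoundedContinuousFunction (CompactSpacetime d) ℂ :=
      BoundedContinuousFunction.mkOfCompact ⟨_, hF⟩
    have h1 := (ProbabilityMeasure.tendsto_iff_forall_integral_rclike_tendsto ℂ).mp hlim F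
    have hFi : ∀ y, F (toCompact d y) = f y := fun y => hι.injective.extend_apply _ _ _
    have h2 : ∀ n, ∫ z, F z ∂((νc ∘ κ) n : Measure (CompactSpacetime d)) = ∫ y, f y ∂(ν (κ n)) := by
      intro n
      change ∫ z, F z ∂((ν (κ n)).map (toCompact d)) = _
      rw [hm.integral_map]
      simp only [hFi]
    have h3 : ∫ z, F z ∂(ρc : Measure (CompactSpacetime d))
        = ∫ y, f y ∂((ρc : Measure (CompactSpacetime d)).comap (toCompact d)) := by
      have h4 := hm.integral_map (μ := (ρc : Measure (CompactSpacetime d)).comap (toCompact d)) F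
      rw [hm.map_comap, setIntegral_eq_integral_of_forall_compl_eq_zero] at h4
      · rw [h4]
        simp only [hFi]
      · intro z hz
        exact Function.extend_apply' _ _ _ hz
    simp only [h2, h3] at h1
    exact h1

/-- A finite measure on space-time whose time marginal is at most `γ` disintegrates into a
measurable family of measures of mass at most one. -/
theorem exists_kernel_of_fst_le {γ : Measure ℝ} [IsProbabilityMeasure γ]
    (hγ : (volume : Measure ℝ) ≪ γ) (ρ : Measure (ℝ × Phase d)) [IsFiniteMeasure ρ]
    (hρ : ρ.fst ≤ γ) :
    ∃ μ : TimeMeasure d, (∀ᵐ t, μ.toKernel t univ ≤ 1) ∧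
      ∀ f : ℝ × Phase d → ℂ, Integrable f ρ →
        ∫ y, f y ∂ρ = ∫ t, ∫ p, f (t, p) ∂(μ.toKernel t) ∂γ := by
  set g := ρ.fst.rnDeriv γ with hg
  have hgm : Measurable g := Measure.measurable_rnDeriv _ _
  have hg1 : ∀ᵐ t ∂γ, g t ≤ 1 := Measure.rnDeriv_le_one_of_le hρ
  let κ : Kernel ℝ (Phase d) := ρ.condKernel.withDensity fun t _ => g t
  have hκ : ∀ t, κ t = g t • ρ.condKernel t := fun t => by
    rw [Kernel.withDensity_apply _ (by fun_prop), withDensity_const]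
  have hmass : ∀ᵐ t, κ t univ ≤ 1 := by
    filter_upwards [hγ.ae_le hg1] with t ht
    rw [hκ, Measure.smul_apply, measure_univ, smul_eq_mul, mul_one]
    exact ht
  refine ⟨⟨κ, fun K _ => ⟨1, ?_⟩⟩, hmass, fun f hf => ?_⟩
  · filter_upwards [hmass] with t ht
    exact (measure_mono (subset_univ K)).trans ht
  · have h1 : ρ.fst = γ.withDensity g :=
      (Measure.withDensity_rnDeriv_eq _ _ (Measure.absolutelyContinuous_of_le hρ)).symm
    have hd := Measure.disintegrate ρ ρ.condKernel
    have h2 : ∫ y, f y ∂ρ = ∫ t, ∫ p, f (t, p) ∂(ρ.condKernel t) ∂ρ.fst := by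
      rw [← hd] at hf
      conv_lhs => rw [← hd]
      exact Measure.integral_compProd hf
    rw [h2, h1, integral_withDensity_eq_integral_toReal_smul hgm
      (hg1.mono fun t ht => ht.trans_lt ENNReal.one_lt_top)]
    simp only [hκ, integral_smul_measure]

/-- Bounded sequences of functions of time that converge against `C_c(ℝ)` converge against
`L¹(ℝ)`. -/
theorem tendsto_integral_mul_of_continuous {W : ℕ → ℝ → ℂ} {w : ℝ → ℂ} {C : ℝ}
    (hWm : ∀ n, AEStronglyMeasurable (W n) volume) (hwm : AEStronglyMeasurable w volume)
    (hW : ∀ n t, ‖W n t‖ ≤ C) (hw : ∀ᵐ t, ‖w t‖ ≤ C)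
    (hlim : ∀ g : ℝ → ℂ, Continuous g → HasCompactSupport g →
      Tendsto (fun n => ∫ t, g t * W n t) atTop (𝓝 (∫ t, g t * w t)))
    {φ : ℝ → ℂ} (hφ : Integrable φ) :
    Tendsto (fun n => ∫ t, φ t * W n t) atTop (𝓝 (∫ t, φ t * w t)) := by
  have hC : 0 ≤ C := (norm_nonneg _).trans (hW 0 0)
  have key : ∀ (v : ℝ → ℂ), AEStronglyMeasurable v volume → (∀ᵐ t, ‖v t‖ ≤ C) →
      ∀ f g : ℝ → ℂ, Integrable f → Integrable g →
      dist (∫ t, f t * v t) (∫ t, g t * v t) ≤ (∫ t, ‖f t - g t‖) * C := by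
    intro v hvm hv f g hf hg
    have hfi : Integrable fun t => f t * v t := hf.mul_bdd hvm hv
    have hgi : Integrable fun t => g t * v t := hg.mul_bdd hvm hv
    rw [dist_eq_norm, ← integral_sub hfi hgi, ← integral_mul_const]
    refine norm_integral_le_of_norm_le ((hf.sub hg).norm.mul_const C) ?_
    filter_upwards [hv] with t ht
    rw [← sub_mul, norm_mul]
    exact mul_le_mul_of_nonneg_left ht (norm_nonneg _)
  rw [Metric.tendsto_nhds]
  intro ε hε
  obtain ⟨g, hgc, hg, hgcont, hgi⟩ := hφ.exists_hasCompactSupport_integral_sub_le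
    (ε := ε / (4 * (C + 1))) (by positivity)
  have hgC : (∫ t, ‖φ t - g t‖) * C ≤ ε / 4 := by
    calc (∫ t, ‖φ t - g t‖) * C ≤ ε / (4 * (C + 1)) * (C + 1) :=
          mul_le_mul hg (by linarith) hC (by positivity)
      _ = ε / 4 := by field_simp
  filter_upwards [Metric.tendsto_nhds.mp (hlim g hgcont hgc) (ε / 4) (by positivity)] with n hn
  have h1 := key (W n) (hWm n) (Eventually.of_forall (hW n)) φ g hφ hgi
  have h2 := key w hwm hw φ g hφ hgi
  rw [dist_comm] at h2
  have h3 := dist_triangle4 (∫ t, φ t * W n t) (∫ t, g t * W n t) (∫ t, g t * w t) (∫ t, φ t * w t)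
  linarith

end Compactness

/-! ### Existence of semiclassical measures -/

section Existence

/-- Windows that are large on the lattice `ℤᵈ` but small at the scale `1/h`: take `N ≈ h^(-1/2)`. -/
theorem exists_window_size {h : ℕ → ℝ} (hpos : ∀ n, 0 < h n) (hh : Tendsto h atTop (𝓝 0)) :
    ∃ N : ℕ → ℕ, (∀ n, 0 < N n) ∧ Tendsto N atTop atTop ∧
      Tendsto (fun n => h n * N n) atTop (𝓝 0) := by
  have hs : Tendsto (fun n => √(h n)) atTop (𝓝 0) := by
    simpa using hh.sqrt
  have hsp : ∀ n, 0 < √(h n) := fun n => Real.sqrt_pos.mpr (hpos n)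
  refine ⟨fun n => ⌈(√(h n))⁻¹⌉₊, fun n => Nat.ceil_pos.mpr (inv_pos.mpr (hsp n)), ?_, ?_⟩
  · refine tendsto_nat_ceil_atTop.comp (tendsto_inv_nhdsGT_zero.comp ?_)
    exact tendsto_nhdsWithin_iff.mpr ⟨hs, Eventually.of_forall hsp⟩
  · refine squeeze_zero (fun n => mul_nonneg (hpos n).le (Nat.cast_nonneg _)) (fun n => ?_)
      (by simpa using hs.add hh)
    calc h n * (⌈(√(h n))⁻¹⌉₊ : ℝ) ≤ h n * ((√(h n))⁻¹ + 1) :=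
          mul_le_mul_of_nonneg_left (Nat.ceil_lt_add_one (inv_pos.mpr (hsp n)).le).le (hpos n).le
      _ = √(h n) + h n := by
          rw [mul_add, mul_one]
          nth_rewrite 1 [← Real.mul_self_sqrt (hpos n).le]
          rw [mul_assoc, mul_inv_cancel₀ (hsp n).ne', mul_one]

/-- Weak-* compactness: time-scaled Wigner distributions of normalised states have subsequences
that converge to a family of positive measures. -/
theorem exists_subseq_tendsto_wigner (H : (Fin d → ℝ) → ℝ) {h : ℕ → ℝ} (hpos : ∀ n, 0 < h n)
    (hh : Tendsto h atTop (𝓝 0)) {u : ℕ → L2Torus d} (hu : ∀ n, ‖u n‖ = 1) (s : ℕ → ℝ) :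
    ∃ (κ : ℕ → ℕ) (μ : TimeMeasure d), StrictMono κ ∧
      ∀ (φ : Lp ℂ 1 (volume : Measure ℝ)) (a : TestFn d),
        Tendsto (fun n => ∫ t, φ t *
            wigner (h (κ n)) (propagator H (h (κ n)) (s (κ n) * t) (u (κ n))) a)
          atTop (𝓝 (pairing μ φ a)) := by
  obtain ⟨N, hN0, hN, hhN⟩ := exists_window_size hpos hh
  set γ : Measure ℝ := gaussianReal 0 1 with hγ
  set c : ℕ → ℝ → (Fin d → ℤ) → ℂ := fun n t k =>
    torusCoeff (propagator H (h n) (s n * t) (u n)) k with hc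
  have hcc : ∀ n k, Continuous fun t => c n t k := fun n k => by
    simp only [hc, torusCoeff_propagator]
    fun_prop
  have hc1 : ∀ n t, HasSum (fun k => ‖c n t k‖ ^ 2) 1 := fun n t => by
    have := hasSum_norm_sq_torusCoeff (propagator H (h n) (s n * t) (u n))
    rwa [norm_propagator, hu, one_pow] at this
  obtain ⟨κ, ρ, hκ, hfin, hρ, hlim⟩ := exists_subseq_tendsto_integral (γ := γ)
    (fun n => isProbabilityMeasure_husimi (γ := γ) (hN0 n) (hcc n) (hc1 n) (h n))
    (fun n => husimi_map_fst (γ := γ) (hN0 n) (hcc n) (hc1 n) (h n))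
  obtain ⟨μ, hμ1, hμ⟩ := exists_kernel_of_fst_le
    (gaussianReal_absolutelyContinuous' 0 one_ne_zero) ρ hρ
  refine ⟨κ, μ, hκ, fun φ a => ?_⟩
  obtain ⟨C, hC0, hC⟩ := exists_wigner_bound a
  obtain ⟨B, hB0, hB⟩ := a.exists_bound
  have hwle : ∀ᵐ t, ‖∫ p, a p ∂(μ.toKernel t)‖ ≤ B := by
    filter_upwards [hμ1] with t ht
    have hf : IsFiniteMeasure (μ.toKernel t) := ⟨ht.trans_lt ENNReal.one_lt_top⟩
    refine (norm_integral_le_of_norm_le_const (Eventually.of_forall hB)).trans ?_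
    refine mul_le_of_le_one_right hB0 ?_
    rw [Measure.real, ← ENNReal.toReal_one]
    exact ENNReal.toReal_mono ENNReal.one_ne_top ht
  have hcontW : ∀ n, Continuous fun t => wigner (h n) (propagator H (h n) (s n * t) (u n)) a :=
    fun n => (continuous_wigner_propagator H (h n) (u n) a).comp (continuous_const_mul (s n))
  refine tendsto_integral_mul_of_continuous (C := max C B)
    (W := fun n t => wigner (h (κ n)) (propagator H (h (κ n)) (s (κ n) * t) (u (κ n))) a)
    (w := fun t => ∫ p, a p ∂(μ.toKernel t))
    (fun n => (hcontW _).aestronglyMeasurable)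
    (a.continuous.stronglyMeasurable.integral_kernel).aestronglyMeasurable
    (fun n t => ?_) (hwle.mono fun t ht => ht.trans (le_max_right _ _)) ?_ (L1.integrable_coeFn φ)
  · refine (hC _ _).trans ?_
    rw [norm_propagator, hu, one_pow, mul_one]
    exact le_max_left _ _
  intro g hg hgc
  -- trade the Lebesgue weight for the Gaussian one
  set ψ : ℝ → ℂ := fun t => ((gaussianPDFReal 0 1 t : ℝ) : ℂ)⁻¹ * g t with hψ
  have hpdf : ∀ t, 0 < gaussianPDFReal 0 1 t := fun t => gaussianPDFReal_pos 0 1 t one_ne_zero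
  have hpdfc : Continuous (gaussianPDFReal 0 1) := by
    unfold gaussianPDFReal
    fun_prop
  have hψc : Continuous ψ := by
    refine Continuous.mul (Continuous.inv₀ (Complex.continuous_ofReal.comp hpdfc) fun t => ?_) hg
    exact_mod_cast (hpdf t).ne'
  have hψs : HasCompactSupport ψ := hgc.mul_left
  obtain ⟨D, hD⟩ := hψs.exists_bound_of_continuous hψc
  have hweight : ∀ v : ℝ → ℂ, ∫ t, g t * v t = ∫ t, ψ t * v t ∂γ := fun v => by
    rw [hγ, integral_gaussianReal_eq_integral_smul one_ne_zero]
    refine integral_congr_ae (Eventually.of_forall fun t => ?_)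
    have : ((gaussianPDFReal 0 1 t : ℝ) : ℂ) ≠ 0 := by exact_mod_cast (hpdf t).ne'
    simp only [hψ, Complex.real_smul]
    field_simp
  simp only [hweight]
  -- the Husimi measures converge
  have hF : Continuous fun y : ℝ × Phase d => ψ y.1 * a y.2 :=
    (hψc.comp continuous_fst).mul (a.continuous.comp continuous_snd)
  have hFs : HasCompactSupport fun y : ℝ × Phase d => ψ y.1 * a y.2 := by
    refine HasCompactSupport.of_support_subset_isCompact
      (hψs.isCompact.prod a.compact.isCompact) fun y hy => ?_
    exact ⟨subset_tsupport _ (left_ne_zero_of_mul hy), subset_tsupport _ (right_ne_zero_of_mul hy)⟩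
  have h1 := hlim _ hF hFs
  simp only [integral_husimi (hN0 _) (hcc _) (hc1 _) _ hψc hD] at h1
  rw [hμ _ (hF.integrable_of_hasCompactSupport hFs)] at h1
  simp only [integral_const_mul] at h1
  -- and they are asymptotic to the Wigner distributions
  obtain ⟨ε, hε, hεle⟩ := exists_tendsto_quadForm_sub a hh hN0 hN hhN
  refine (tendsto_iff_of_dist ?_).mp h1
  refine squeeze_zero (fun n => dist_nonneg) (g := fun n => D * ε (κ n)) (fun n => ?_)
    (by simpa using (hε.comp hκ.tendsto_atTop).const_mul D)
  have hD0 : 0 ≤ D := (norm_nonneg _).trans (hD 0)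
  have hi1 : Integrable (fun t => ψ t * wigner (h (κ n))
      (propagator H (h (κ n)) (s (κ n) * t) (u (κ n))) a) γ :=
    Integrable.of_bound (hψc.mul (hcontW _)).aestronglyMeasurable (D * C)
      (Eventually.of_forall fun t => by
        rw [norm_mul]
        refine mul_le_mul (hD t) ((hC _ _).trans_eq ?_) (norm_nonneg _) hD0
        rw [norm_propagator, hu, one_pow, mul_one])
  have hqc : Continuous fun t => quadForm (windowMatrix (h (κ n)) (N (κ n)) a) (c (κ n) t) := by
    obtain ⟨A, hA, hAa⟩ := exists_summable_weylCoeff_bound a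
    simp only [quadForm]
    refine continuous_tsum (fun p => ?_) (summable_quadForm_majorant hA
      (fun m => (norm_nonneg _).trans (hAa m 0)) (hc1 (κ n) 0).summable) fun p t => ?_
    · exact continuous_const.mul ((hcc _ _).mul (Complex.continuous_conj.comp (hcc _ _)))
    · refine (norm_quadForm_term_le
        (fun m k => norm_windowMatrix_le (hN0 (κ n)) hAa m k) p).trans_eq ?_
      simp only [hc, norm_torusCoeff_propagator]
  have hdiff : ∀ t, ‖quadForm (windowMatrix (h (κ n)) (N (κ n)) a) (c (κ n) t)
      - wigner (h (κ n)) (propagator H (h (κ n)) (s (κ n) * t) (u (κ n))) a‖ ≤ ε (κ n) := fun t => by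
    have := hεle (κ n) (c (κ n) t) (hc1 _ t).summable
    rw [(hc1 _ t).tsum_eq, mul_one] at this
    rwa [norm_sub_rev, wigner_eq_quadForm]
  have hi2 : Integrable (fun t => ψ t * quadForm (windowMatrix (h (κ n)) (N (κ n)) a) (c (κ n) t))
      γ := by
    refine Integrable.of_bound (hψc.mul hqc).aestronglyMeasurable (D * (C + ε (κ n)))
      (Eventually.of_forall fun t => ?_)
    rw [norm_mul]
    refine mul_le_mul (hD t) ?_ (norm_nonneg _) hD0
    have h2 := hC (h (κ n)) (propagator H (h (κ n)) (s (κ n) * t) (u (κ n)))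
    rw [norm_propagator, hu, one_pow, mul_one] at h2
    have h3 := norm_le_norm_add_norm_sub (wigner (h (κ n))
      (propagator H (h (κ n)) (s (κ n) * t) (u (κ n))) a)
      (quadForm (windowMatrix (h (κ n)) (N (κ n)) a) (c (κ n) t))
    linarith [hdiff t, norm_sub_rev (wigner (h (κ n))
      (propagator H (h (κ n)) (s (κ n) * t) (u (κ n))) a)
      (quadForm (windowMatrix (h (κ n)) (N (κ n)) a) (c (κ n) t))]
  rw [dist_eq_norm, ← integral_sub hi2 hi1]
  refine (norm_integral_le_of_norm_le_const (C := D * ε (κ n))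
    (Eventually.of_forall fun t => ?_)).trans_eq (by simp)
  rw [← mul_sub, norm_mul]
  exact mul_le_mul (hD t) (hdiff t) (norm_nonneg _) hD0

end Existence

/-! ### Lebesgue points of a family of measures -/

section LebesguePoints

/-- The compact sets `𝕋ᵈ × B(0, j)`, which exhaust the phase space. -/
def phaseBall (d j : ℕ) : Set (Phase d) := univ ×ˢ Metric.closedBall 0 j

theorem isCompact_phaseBall (d j : ℕ) : IsCompact (phaseBall d j) :=
  isCompact_univ.prod (isCompact_closedBall _ _)

theorem exists_subset_phaseBall {K : Set (Phase d)} (hK : IsCompact K) :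
    ∃ j, K ⊆ phaseBall d j := by
  obtain ⟨r, hr⟩ := (hK.image continuous_snd).isBounded.subset_closedBall 0
  obtain ⟨j, hj⟩ := exists_nat_ge r
  exact ⟨j, fun p hp => ⟨mem_univ _, Metric.closedBall_subset_closedBall hj (hr ⟨p, hp, rfl⟩)⟩⟩

/-- There are countably many test functions that approximate all others uniformly, with control of
the supports. -/
theorem exists_countable_dense_testFn (d : ℕ) : ∃ D : Set (TestFn d), D.Countable ∧
    ∀ a : TestFn d, ∃ j, (∀ p ∉ phaseBall d j, a p = 0) ∧ ∀ ε > 0, ∃ b ∈ D,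
      (∀ p ∉ phaseBall d j, b p = 0) ∧ ∀ p, ‖a p - b p‖ ≤ ε := by
  have hj : ∀ j, ∃ D : Set (TestFn d), D.Countable ∧
      ∀ a : TestFn d, (∀ p ∉ phaseBall d j, a p = 0) → ∀ ε > 0, ∃ b ∈ D,
        (∀ p ∉ phaseBall d j, b p = 0) ∧ ∀ p, ‖a p - b p‖ ≤ ε := by
    intro j
    have hc : CompactSpace (phaseBall d j) := isCompact_iff_compactSpace.mp (isCompact_phaseBall d j)
    let res : TestFn d → C(phaseBall d j, ℂ) := fun a =>
      ⟨fun p => a p, a.continuous.comp continuous_subtype_val⟩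
    let T : Set (TestFn d) := {a | ∀ p ∉ phaseBall d j, a p = 0}
    obtain ⟨t, hts, htc, hd⟩ := (TopologicalSpace.IsSeparable.of_separableSpace
      (res '' T)).exists_countable_dense_subset
    choose g hgT hg using fun f : t => hts f.2
    have htc' : Countable t := htc.to_subtype
    refine ⟨range g, countable_range g, fun a ha ε hε => ?_⟩
    obtain ⟨f, hf, hdist⟩ := Metric.mem_closure_iff.mp (hd ⟨a, ha, rfl⟩) ε hε
    refine ⟨g ⟨f, hf⟩, ⟨⟨f, hf⟩, rfl⟩, hgT ⟨f, hf⟩, fun p => ?_⟩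
    by_cases hp : p ∈ phaseBall d j
    · have h1 := (ContinuousMap.dist_apply_le_dist (f := res a) (g := f) ⟨p, hp⟩).trans hdist.le
      have h2 : res (g ⟨f, hf⟩) = f := hg ⟨f, hf⟩
      rw [← h2, dist_eq_norm] at h1
      exact h1
    · rw [ha p hp, hgT ⟨f, hf⟩ p hp, sub_zero, norm_zero]
      exact hε.le
  choose D hDc hD using hj
  refine ⟨⋃ j, D j, countable_iUnion hDc, fun a => ?_⟩
  obtain ⟨j, hj⟩ := exists_subset_phaseBall a.compact.isCompact
  have ha : ∀ p ∉ phaseBall d j, a p = 0 := fun p hp =>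
    image_eq_zero_of_notMem_tsupport fun h => hp (hj h)
  refine ⟨j, ha, fun ε hε => ?_⟩
  obtain ⟨b, hb, hb'⟩ := hD j a ha ε hε
  exact ⟨b, mem_iUnion.mpr ⟨j, hb⟩, hb'⟩

/-- The function `t ↦ ∫ a dμ(t, ·)`. -/
def TimeMeasure.eval (μ : TimeMeasure d) (a : TestFn d) (t : ℝ) : ℂ := ∫ p, a p ∂(μ.toKernel t)

theorem TimeMeasure.stronglyMeasurable_eval (μ : TimeMeasure d) (a : TestFn d) :
    StronglyMeasurable (μ.eval a) :=
  a.continuous.stronglyMeasurable.integral_kernel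

theorem norm_integral_le_of_support_subset {ν : Measure (Phase d)} {K : Set (Phase d)}
    {C : ℝ≥0} (hC : ν K ≤ C) {f : Phase d → ℂ} (hf : ∀ p ∉ K, f p = 0) {B : ℝ} (hB0 : 0 ≤ B)
    (hB : ∀ p, ‖f p‖ ≤ B) : ‖∫ p, f p ∂ν‖ ≤ B * C := by
  rw [← setIntegral_eq_integral_of_forall_compl_eq_zero hf]
  refine (norm_setIntegral_le_of_norm_le_const (hC.trans_lt ENNReal.coe_lt_top)
    fun p _ => hB p).trans ?_
  refine mul_le_mul_of_nonneg_left ?_ hB0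
  rw [Measure.real, ← ENNReal.coe_toReal]
  exact ENNReal.toReal_mono ENNReal.coe_ne_top hC

theorem TestFn.integrable_of_measure_le (a : TestFn d) {ν : Measure (Phase d)}
    {K : Set (Phase d)} {C : ℝ≥0} (hC : ν K ≤ C) (ha : ∀ p ∉ K, a p = 0) :
    Integrable a.toFun ν := by
  obtain ⟨B, _, hB⟩ := a.exists_bound
  have h : IntegrableOn a.toFun K ν :=
    Measure.integrableOn_of_bounded (hC.trans_lt ENNReal.coe_lt_top).ne
      a.continuous.aestronglyMeasurable (M := B) (Eventually.of_forall hB)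
  rw [← integrableOn_iff_integrable_of_support_subset (s := K)]
  · exact h
  · intro p hp
    by_contra hn
    exact hp (ha p hn)

theorem TimeMeasure.locallyIntegrable_eval (μ : TimeMeasure d) (a : TestFn d) :
    LocallyIntegrable (μ.eval a) := by
  obtain ⟨B, hB0, hB⟩ := a.exists_bound
  obtain ⟨C, hC⟩ := μ.bounded _ a.compact.isCompact
  have h : MemLp (μ.eval a) ∞ volume :=
    memLp_top_of_bound (μ.stronglyMeasurable_eval a).aestronglyMeasurable (B * C) <| by
      filter_upwards [hC] with t ht
      exact norm_integral_le_of_support_subset ht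
        (fun p hp => image_eq_zero_of_notMem_tsupport hp) hB0 hB
  exact h.locallyIntegrable le_top

/-- Almost every time is a Lebesgue point of `t ↦ ∫ a dμ(t, ·)`, for all test functions `a`
simultaneously. -/
theorem TimeMeasure.ae_tendsto_average (μ : TimeMeasure d) :
    ∀ᵐ t₀ : ℝ, (∀ K, IsCompact K → ∃ C : ℝ≥0, μ.toKernel t₀ K ≤ C) ∧ ∀ a : TestFn d,
      Tendsto (fun δ : ℝ => δ⁻¹ • ∫ t in t₀..t₀ + δ, μ.eval a t) (𝓝[>] 0) (𝓝 (μ.eval a t₀)) := by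
  obtain ⟨D, hDc, hD⟩ := exists_countable_dense_testFn d
  choose C hC using fun j => μ.bounded _ (isCompact_phaseBall d j)
  have hC' : ∀ᵐ t : ℝ, ∀ j, μ.toKernel t (phaseBall d j) ≤ C j := ae_all_iff.mpr hC
  have hderiv : ∀ᵐ t₀ : ℝ, ∀ b ∈ D, ∀ c : ℝ,
      HasDerivAt (fun x => ∫ t in c..x, μ.eval b t) (μ.eval b t₀) t₀ :=
    (ae_ball_iff hDc).mpr fun b _ => LocallyIntegrable.ae_hasDerivAt_integral (μ.locallyIntegrable_eval b)
  filter_upwards [hC', hderiv] with t₀ ht₀ hb₀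
  refine ⟨fun K hK => ?_, fun a => ?_⟩
  · obtain ⟨j, hj⟩ := exists_subset_phaseBall hK
    exact ⟨C j, (measure_mono hj).trans (ht₀ j)⟩
  obtain ⟨j, haj, happ⟩ := hD a
  rw [Metric.tendsto_nhds]
  intro ε hε
  obtain ⟨b, hbD, hbj, hab⟩ := happ (ε / (4 * (C j + 1))) (by positivity)
  -- replacing `a` by `b` changes the values by at most `ε / 4`
  have hdiff : ∀ t, μ.toKernel t (phaseBall d j) ≤ C j → ‖μ.eval a t - μ.eval b t‖ ≤ ε / 4 := by
    intro t ht
    rw [TimeMeasure.eval, TimeMeasure.eval, ← integral_sub (a.integrable_of_measure_le ht haj)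
      (b.integrable_of_measure_le ht hbj)]
    refine (norm_integral_le_of_support_subset ht (f := fun p => a p - b p)
      (fun p hp => by rw [haj p hp, hbj p hp, sub_zero]) (by positivity) hab).trans ?_
    calc ε / (4 * (C j + 1)) * C j ≤ ε / (4 * (C j + 1)) * (C j + 1) :=
          mul_le_mul_of_nonneg_left (by linarith) (by positivity)
      _ = ε / 4 := by field_simp
  have hlim : Tendsto (fun δ : ℝ => δ⁻¹ • ∫ t in t₀..t₀ + δ, μ.eval b t) (𝓝[>] 0)
      (𝓝 (μ.eval b t₀)) := by
    simpa using (hb₀ b hbD t₀).tendsto_slope_zero_right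
  filter_upwards [Metric.tendsto_nhds.mp hlim (ε / 4) (by positivity), self_mem_nhdsWithin]
    with δ hδ hδ0
  have hδ0' : (0 : ℝ) < δ := hδ0
  have hint : ∀ b : TestFn d, IntervalIntegrable (μ.eval b) volume t₀ (t₀ + δ) := fun b =>
    ((μ.locallyIntegrable_eval b).integrableOn_isCompact isCompact_uIcc).intervalIntegrable
  have h1 : dist (δ⁻¹ • ∫ t in t₀..t₀ + δ, μ.eval a t) (δ⁻¹ • ∫ t in t₀..t₀ + δ, μ.eval b t)
      ≤ ε / 4 := by
    rw [dist_eq_norm, ← smul_sub, ← intervalIntegral.integral_sub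
      (hint a)
      (hint b), norm_smul, norm_inv,
      Real.norm_of_nonneg hδ0'.le, inv_mul_le_iff₀ hδ0']
    have h2 := intervalIntegral.norm_integral_le_of_norm_le_const_ae (a := t₀) (b := t₀ + δ)
      (f := fun t => μ.eval a t - μ.eval b t) (C := ε / 4)
      (by filter_upwards [hC'] with t ht _ using hdiff t (ht j))
    rw [add_sub_cancel_left, abs_of_pos hδ0'] at h2
    linarith
  have h3 : dist (μ.eval b t₀) (μ.eval a t₀) ≤ ε / 4 := by
    rw [dist_comm, dist_eq_norm]
    exact hdiff t₀ (ht₀ j)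
  have h4 := dist_triangle4 (δ⁻¹ • ∫ t in t₀..t₀ + δ, μ.eval a t)
    (δ⁻¹ • ∫ t in t₀..t₀ + δ, μ.eval b t) (μ.eval b t₀) (μ.eval a t₀)
  linarith

end LebesguePoints

/-! ### Continuous functionals on products -/

section Functionals

/-- A continuous linear functional on a product depends on finitely many coordinates. -/
theorem exists_finset_sum_single {ι : Type*} [DecidableEq ι] {X : Type*} [TopologicalSpace X]
    [AddCommGroup X] [Module ℝ X] (l : (ι → X) →L[ℝ] ℝ) :
    ∃ s : Finset ι, ∀ F : ι → X, l F = ∑ i ∈ s, l (Pi.single i (F i)) := by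
  have hU : {F : ι → X | |l F| < 1} ∈ 𝓝 (0 : ι → X) := by
    have : Tendsto (fun F => |l F|) (𝓝 0) (𝓝 |l 0|) := l.continuous.abs.continuousAt
    rw [map_zero, abs_zero] at this
    exact this.eventually_lt_const one_pos
  rw [nhds_pi, Filter.mem_pi] at hU
  obtain ⟨I, hI, t, ht, hsub⟩ := hU
  have hzero : ∀ F : ι → X, (∀ i ∈ I, F i = 0) → l F = 0 := by
    intro F hF
    have h1 : ∀ c : ℝ, |c * l F| < 1 := fun c => by
      have : c • F ∈ {F : ι → X | |l F| < 1} := hsub fun i hi => by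
        rw [Pi.smul_apply, hF i hi, smul_zero]
        exact mem_of_mem_nhds (ht i)
      simpa using this
    by_contra hne
    have := h1 (l F)⁻¹
    rw [inv_mul_cancel₀ hne, abs_one] at this
    exact lt_irrefl _ this
  refine ⟨hI.toFinset, fun F => ?_⟩
  rw [← map_sum, ← sub_eq_zero, ← map_sub]
  refine hzero _ fun i hi => ?_
  rw [Pi.sub_apply, Finset.sum_apply, Finset.sum_pi_single, if_pos (hI.mem_toFinset.mpr hi),
    sub_self]

theorem exists_finset_sum_apply {A B : Type*} (l : (A → B → ℂ) →L[ℝ] ℝ) :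
    ∃ (s : Finset (Σ _ : A, B)) (L : (Σ _ : A, B) → ℂ →L[ℝ] ℝ),
      ∀ F : A → B → ℂ, l F = ∑ i ∈ s, L i (F i.1 i.2) := by
  classical
  obtain ⟨s, hs⟩ := exists_finset_sum_single l
  choose t ht using fun x : A => exists_finset_sum_single
    (l.comp (ContinuousLinearMap.single ℝ (fun _ : A => B → ℂ) x))
  refine ⟨s.sigma t, fun i => (l.comp (ContinuousLinearMap.single ℝ (fun _ : A => B → ℂ) i.1)).comp
    (ContinuousLinearMap.single ℝ (fun _ : B => ℂ) i.2), fun F => ?_⟩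
  rw [Finset.sum_sigma, hs]
  exact Finset.sum_congr rfl fun x _ => ht x (F x)

end Functionals

/-! ### Averages over short time windows -/

section Averages

/-- If `w_n` converges in mean on an interval, then so do its averages along slow shifts. -/
theorem tendsto_integral_integral_shift {w : ℕ → ℝ → ℂ} {C : ℝ} (hwc : ∀ n, Continuous (w n))
    (hwC : ∀ n t, ‖w n t‖ ≤ C) {r : ℕ → ℝ} (hr : Tendsto r atTop (𝓝 0)) {φ : ℝ → ℂ}
    (hφ : Integrable φ) {t₀ δ : ℝ} (hδ : 0 ≤ δ) {ℓ : ℂ}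
    (hlim : Tendsto (fun n => ∫ t in t₀..t₀ + δ, w n t) atTop (𝓝 ℓ)) :
    Tendsto (fun n => ∫ t in t₀..t₀ + δ, ∫ s, φ s * w n (t + r n * s)) atTop
      (𝓝 ((∫ s, φ s) * ℓ)) := by
  have hswap : ∀ n, ∫ t in t₀..t₀ + δ, ∫ s, φ s * w n (t + r n * s)
      = ∫ s, φ s * ∫ t in t₀..t₀ + δ, w n (t + r n * s) := by
    intro n
    have hint : Integrable (Function.uncurry fun t s => φ s * w n (t + r n * s))
        ((volume.restrict (Ioc t₀ (t₀ + δ))).prod volume) := by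
      have h1 : Integrable (fun z : ℝ × ℝ => φ z.2)
          ((volume.restrict (Ioc t₀ (t₀ + δ))).prod volume) := hφ.comp_snd _
      refine h1.mul_bdd (c := C) ?_ (Eventually.of_forall fun z => hwC _ _)
      exact ((hwc n).comp (by fun_prop)).aestronglyMeasurable
    simp only [intervalIntegral.integral_of_le (le_add_of_nonneg_right hδ)]
    rw [integral_integral_swap hint]
    simp only [integral_const_mul]
  simp only [hswap]
  rw [← integral_mul_const]
  refine tendsto_integral_of_dominated_convergence (fun s => ‖φ s‖ * (C * δ)) (fun n => ?_)
    (hφ.norm.mul_const _) (fun n => Eventually.of_forall fun s => ?_)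
    (Eventually.of_forall fun s => ?_)
  · refine hφ.aestronglyMeasurable.mul (Continuous.aestronglyMeasurable ?_)
    refine intervalIntegral.continuous_parametric_intervalIntegral_of_continuous' ?_ _ _
    exact (hwc n).comp (by fun_prop)
  · rw [norm_mul]
    refine mul_le_mul_of_nonneg_left ?_ (norm_nonneg _)
    have := intervalIntegral.norm_integral_le_of_norm_le_const (a := t₀) (b := t₀ + δ)
      (f := fun t => w n (t + r n * s)) (C := C) fun t _ => hwC _ _
    rwa [add_sub_cancel_left, abs_of_nonneg hδ] at this
  · refine Tendsto.const_mul _ ((tendsto_iff_of_dist ?_).mp hlim)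
    have hsmall : Tendsto (fun n => 2 * (C * |r n * s|)) atTop (𝓝 0) := by
      have h1 : Tendsto (fun n => r n * s) atTop (𝓝 0) := by simpa using hr.mul_const s
      simpa using (h1.abs.const_mul C).const_mul 2
    refine squeeze_zero (fun _ => dist_nonneg) (fun n => ?_) hsmall
    have hi : ∀ x y, IntervalIntegrable (w n) volume x y := fun x y =>
      (hwc n).intervalIntegrable x y
    -- the two intervals of integration differ by two intervals of length `|r n * s|`
    rw [intervalIntegral.integral_comp_add_right, dist_eq_norm,
      intervalIntegral.integral_interval_sub_interval_comm (hi _ _) (hi _ _) (hi _ _)]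
    have hb : ∀ x, ‖∫ t in x..x + r n * s, w n t‖ ≤ C * |r n * s| := fun x => by
      have := intervalIntegral.norm_integral_le_of_norm_le_const (a := x) (b := x + r n * s)
        (f := w n) (C := C) fun t _ => hwC _ _
      rwa [add_sub_cancel_left] at this
    refine (norm_sub_le _ _).trans ?_
    linarith [hb t₀, hb (t₀ + δ)]

theorem continuous_integral_mul_shift {w : ℝ → ℂ} {C : ℝ} (hwc : Continuous w)
    (hwC : ∀ t, ‖w t‖ ≤ C) (r : ℝ) {φ : ℝ → ℂ} (hφ : Integrable φ) :
    Continuous fun t => ∫ s, φ s * w (t + r * s) := by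
  refine continuous_of_dominated (bound := fun s => ‖φ s‖ * C) (fun t => ?_)
    (fun t => Eventually.of_forall fun s => ?_) (hφ.norm.mul_const C)
    (Eventually.of_forall fun s => ?_)
  · exact hφ.aestronglyMeasurable.mul (hwc.comp (by fun_prop)).aestronglyMeasurable
  · rw [norm_mul]
    exact mul_le_mul_of_nonneg_left (hwC _) (norm_nonneg _)
  · exact continuous_const.mul (hwc.comp (by fun_prop))

end Averages

/-! ### Stationary families in the closed convex hull -/

section Main

/-- The family of measures that is constantly equal to a given locally finite measure. -/
def TimeMeasure.const (ν : Measure (Phase d))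
    (hν : ∀ K, IsCompact K → ∃ C : ℝ≥0, ν K ≤ C) : TimeMeasure d where
  toKernel := Kernel.const ℝ ν
  bounded K hK := by
    obtain ⟨C, hC⟩ := hν K hK
    exact ⟨C, Eventually.of_forall fun t => by simpa using hC⟩

theorem pairing_const (ν : Measure (Phase d)) (hν : ∀ K, IsCompact K → ∃ C : ℝ≥0, ν K ≤ C)
    (φ : Lp ℂ 1 (volume : Measure ℝ)) (a : TestFn d) :
    pairing (TimeMeasure.const ν hν) φ a = (∫ t, φ t) * ∫ p, a p ∂ν := by
  simp only [pairing, TimeMeasure.const, Kernel.const_apply, integral_mul_const]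

/-- At a Lebesgue point `t₀` of `μ`, the stationary family `μ(t₀, ·)` lies in the closed convex
hull of the semiclassical measures at the shorter time scale `σ`. -/
theorem const_mem_closedConvHull (H : (Fin d → ℝ) → ℝ) {τ σ : ℝ → ℝ}
    (hτ_pos : ∀ h, 0 < h → 0 < τ h)
    (hστ : Tendsto (fun h => σ h / τ h) (𝓝[>] 0) (𝓝 0)) {μ : TimeMeasure d}
    (hμ : μ ∈ semiclassicalMeasures H τ) {t₀ : ℝ}
    (hfin : ∀ K, IsCompact K → ∃ C : ℝ≥0, μ.toKernel t₀ K ≤ C)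
    (hleb : ∀ a : TestFn d, Tendsto (fun δ : ℝ => δ⁻¹ • ∫ t in t₀..t₀ + δ, μ.eval a t) (𝓝[>] 0)
      (𝓝 (μ.eval a t₀))) :
    TimeMeasure.const (μ.toKernel t₀) hfin ∈ closedConvHull (semiclassicalMeasures H σ) := by
  obtain ⟨h, u, hpos, hh, hu, hlim⟩ := hμ
  by_contra hnot
  obtain ⟨l, q, hlq, hq⟩ := geometric_hahn_banach_closed_point
    (convex_closedConvexHull (𝕜 := ℝ)) isClosed_closedConvexHull hnot
  obtain ⟨I, L, hL⟩ := exists_finset_sum_apply l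
  set w : TestFn d → ℕ → ℝ → ℂ := fun a n t =>
    wigner (h n) (propagator H (h n) (τ (h n) * t) (u n)) a with hw
  have hwc : ∀ a n, Continuous (w a n) := fun a n =>
    (continuous_wigner_propagator H (h n) (u n) a).comp (continuous_const_mul (τ (h n)))
  have hwb : ∀ a, ∃ C, ∀ n t, ‖w a n t‖ ≤ C := fun a => by
    obtain ⟨C, _, hC⟩ := exists_wigner_bound a
    refine ⟨C, fun n t => (hC _ _).trans_eq ?_⟩
    rw [norm_propagator, hu, one_pow, mul_one]
  choose C hC using hwb
  set r : ℕ → ℝ := fun n => σ (h n) / τ (h n) with hr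
  have hr0 : Tendsto r atTop (𝓝 0) :=
    hστ.comp (tendsto_nhdsWithin_iff.mpr ⟨hh, Eventually.of_forall hpos⟩)
  -- the time-scaled Wigner distributions at scale `σ`, started at the time `τ t`
  set V : ℕ → ℝ → Lp ℂ 1 (volume : Measure ℝ) → TestFn d → ℂ := fun n t φ a =>
    ∫ s, φ s * w a n (t + r n * s) with hV
  have hVeq : ∀ n t φ a, V n t φ a = ∫ s, φ s * wigner (h n) (propagator H (h n) (σ (h n) * s)
      (propagator H (h n) (τ (h n) * t) (u n))) a := by
    intro n t φ a
    simp only [hV, hw, propagator_propagator]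
    have hne : τ (h n) ≠ 0 := (hτ_pos _ (hpos n)).ne'
    have hts : ∀ s, τ (h n) * (t + r n * s) = σ (h n) * s + τ (h n) * t := fun s => by
      simp only [hr]
      field_simp
      ring
    simp only [hts]
  have hVc : ∀ n φ a, Continuous fun t => V n t φ a := fun n φ a =>
    continuous_integral_mul_shift (hwc a n) (hC a n) (r n) (L1.integrable_coeFn φ)
  -- a short time interval on which `μ` is close to `μ(t₀, ·)`
  have hδlim : Tendsto (fun δ : ℝ => ∑ i ∈ I, L i ((∫ s, i.1 s) *
      (δ⁻¹ • ∫ t in t₀..t₀ + δ, μ.eval i.2 t))) (𝓝[>] 0)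
      (𝓝 (l (pairing (TimeMeasure.const (μ.toKernel t₀) hfin)))) := by
    rw [hL]
    refine tendsto_finsetSum _ fun i _ => ((L i).continuous.tendsto _).comp ?_
    rw [pairing_const]
    exact (hleb i.2).const_mul _
  obtain ⟨δ, hδq, hδ0⟩ := ((hδlim.eventually_const_lt hq).and self_mem_nhdsWithin).exists
  have hδ0' : (0 : ℝ) < δ := hδ0
  -- the averages over that interval converge
  have hVlim : Tendsto (fun n => δ⁻¹ * ∫ t in t₀..t₀ + δ, l (V n t)) atTop
      (𝓝 (∑ i ∈ I, L i ((∫ s, i.1 s) * (δ⁻¹ • ∫ t in t₀..t₀ + δ, μ.eval i.2 t)))) := by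
    have h1 : ∀ n, δ⁻¹ * ∫ t in t₀..t₀ + δ, l (V n t)
        = ∑ i ∈ I, L i (δ⁻¹ • ∫ t in t₀..t₀ + δ, V n t i.1 i.2) := by
      intro n
      have hLc : ∀ i ∈ I, Continuous fun t => L i (V n t i.1 i.2) := fun i _ =>
        (L i).continuous.comp (hVc n i.1 i.2)
      simp only [hL]
      rw [intervalIntegral.integral_finsetSum fun i hi => (hLc i hi).intervalIntegrable _ _, Finset.mul_sum]
      refine Finset.sum_congr rfl fun i _ => ?_
      rw [map_smul, smul_eq_mul, (L i).intervalIntegral_comp_comm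
        ((hVc n i.1 i.2).intervalIntegrable _ _)]
    simp only [h1]
    refine tendsto_finsetSum _ fun i _ => ((L i).continuous.tendsto _).comp ?_
    rw [mul_smul_comm]
    refine Tendsto.const_smul ?_ _
    refine tendsto_integral_integral_shift (hwc i.2) (hC i.2) hr0 (L1.integrable_coeFn i.1)
      hδ0'.le ?_
    have h2 := hlim (indicatorConstLp 1 (measurableSet_Ioc (a := t₀) (b := t₀ + δ))
      (by simp) (1 : ℂ)) i.2
    have h3 : ∀ v : ℝ → ℂ, ∫ t, (indicatorConstLp 1 (measurableSet_Ioc (a := t₀) (b := t₀ + δ))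
        (μ := volume) (by simp) (1 : ℂ) : ℝ → ℂ) t * v t = ∫ t in t₀..t₀ + δ, v t := by
      intro v
      rw [intervalIntegral.integral_of_le (le_add_of_nonneg_right hδ0'.le),
        ← integral_indicator measurableSet_Ioc]
      refine integral_congr_ae ?_
      filter_upwards [indicatorConstLp_coeFn (p := 1)
        (hs := measurableSet_Ioc (a := t₀) (b := t₀ + δ)) (μ := (volume : Measure ℝ))
        (hμs := by simp) (c := (1 : ℂ))] with t ht
      rw [ht]
      by_cases hmem : t ∈ Ioc t₀ (t₀ + δ)
      · simp [hmem]
      · simp [hmem]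
    simp only [pairing, h3] at h2
    exact h2
  -- hence some time in the interval is at least as good as the average
  obtain ⟨q', hqq', hq'⟩ := exists_between hδq
  have hex : ∀ᶠ n in atTop, ∃ t, q' ≤ l (V n t) := by
    filter_upwards [hVlim.eventually_const_lt hq'] with n hn
    by_contra! hcon
    have hlc : Continuous fun t => l (V n t) := by
      simp only [hL]
      exact continuous_finsetSum _ fun i _ => (L i).continuous.comp (hVc n i.1 i.2)
    have h1 := intervalIntegral.integral_mono_on (le_add_of_nonneg_right hδ0'.le)
      (hlc.intervalIntegrable (μ := volume) t₀ (t₀ + δ)) intervalIntegrable_const fun t _ => (hcon t).le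
    rw [intervalIntegral.integral_const, add_sub_cancel_left, smul_eq_mul] at h1
    have h2 := mul_le_mul_of_nonneg_left h1 (inv_nonneg.mpr hδ0'.le)
    rw [inv_mul_cancel_left₀ hδ0'.ne'] at h2
    linarith
  have hex' : ∀ n, ∃ t, (∃ t, q' ≤ l (V n t)) → q' ≤ l (V n t) := fun n => by
    by_cases hn : ∃ t, q' ≤ l (V n t)
    · exact ⟨hn.choose, fun _ => hn.choose_spec⟩
    · exact ⟨0, fun hc => absurd hc hn⟩
  choose t ht using hex'
  -- restart the evolution at these times
  obtain ⟨κ, ν, hκ, hν⟩ := exists_subseq_tendsto_wigner H hpos hh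
    (u := fun n => propagator H (h n) (τ (h n) * t n) (u n))
    (fun n => by rw [norm_propagator, hu]) (fun n => σ (h n))
  have hνmem : ν ∈ semiclassicalMeasures H σ :=
    ⟨h ∘ κ, fun n => propagator H (h (κ n)) (τ (h (κ n)) * t (κ n)) (u (κ n)),
      fun n => hpos _, hh.comp hκ.tendsto_atTop, fun n => by rw [norm_propagator, hu], hν⟩
  have hνlim : Tendsto (fun n => l (V (κ n) (t (κ n)))) atTop (𝓝 (l (pairing ν))) := by
    simp only [hL, hVeq]
    exact tendsto_finsetSum _ fun i _ => ((L i).continuous.tendsto _).comp (hν i.1 i.2)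
  have hge : q' ≤ l (pairing ν) := by
    refine ge_of_tendsto hνlim ?_
    filter_upwards [hκ.tendsto_atTop.eventually hex] with n hn
    exact ht _ hn
  have hlt := hlq _ (subset_closedConvexHull ⟨ν, hνmem, rfl⟩)
  linarith

end Main

end TorusSchrodinger

end

theorem propositionp (d : ℕ) (H : (Fin d → ℝ) → ℝ) (hH : ContDiff ℝ ∞ H)
    (τ σ : ℝ → ℝ) (hτ_pos : ∀ h, 0 < h → 0 < τ h) (hσ_pos : ∀ h, 0 < h → 0 < σ h)
    (hτ : Tendsto τ (𝓝[>] 0) atTop) (hσ : Tendsto σ (𝓝[>] 0) atTop)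
    (hστ : Tendsto (fun h => σ h / τ h) (𝓝[>] 0) (𝓝 0))
    (μ : TorusSchrodinger.TimeMeasure d)
    (hμ : μ ∈ TorusSchrodinger.semiclassicalMeasures H τ) :
    ∀ᵐ t : ℝ, ∃ μt ∈ TorusSchrodinger.closedConvHull
        (TorusSchrodinger.semiclassicalMeasures H σ),
      μ.toKernel t = Measure.bind (volume.restrict (Icc (0 : ℝ) 1)) μt.toKernel := by
  filter_upwards [μ.ae_tendsto_average] with t ⟨hfin, hleb⟩
  refine ⟨TorusSchrodinger.TimeMeasure.const (μ.toKernel t) hfin,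
    TorusSchrodinger.const_mem_closedConvHull H hτ_pos hστ hμ hfin hleb, ?_⟩
  have h1 : (TorusSchrodinger.TimeMeasure.const (μ.toKernel t) hfin).toKernel
      = Kernel.const ℝ (μ.toKernel t) := rfl
  rw [h1, show ⇑(Kernel.const ℝ (μ.toKernel t)) = fun _ => μ.toKernel t from rfl,
    Measure.bind_const, Measure.restrict_apply_univ, Real.volume_Icc,
    sub_zero, ENNReal.ofReal_one, one_smul]
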